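/- **Model.** There are $N$ users and infinitely many items $i\in\mathbb N$. User types $\tau_U(u)$ are i.i.d. uniform on $[q_U]$, where $q_U\le N$; item types $\tau_I(i)$ are i.i.d. uniform on $[q_I]$; the entries of $\Xi=(\xi_{k,j})\in\{-1,+1\}^{q_U\times q_I}$ are i.i.d. fair signs; all of these are independent. User $u$ rates item $i$ as $L_{u,i}=\xi_{\tau_U(u),\tau_I(i)}$ ($+1$ = like). At each time $t=1,2,\dots$ an algorithm recommends to each user $u$ an item $a_{u,t}$, depending on the past recommendations and ratings and on independent randomness, and then sees $L_{u,a_{u,t}}$. Put $$\mathrm{regret}(T)=\mathbb E\sum_{t=1}^T\frac1N\sum_{u=1}^N \mathbf 1[L_{u,a_{u,t}}=-1].$$ Logarithms are to base 2. **Algorithm Item-Item** (inputs $T,q_I,N$). Let $$r=\lceil 2\log(2Nq_I^2)\rceil,\qquad \ell=\min\Big\{\Big\lceil 18\log T+\sqrt{330\tfrac{q_I r}{N}T}\Big\rceil,q_I\Big\},\qquad M=\Big\lceil\tfrac{64 q_I}{\ell}T\Big\rceil .$$ Take two disjoint sets $\mathcal M,\widetilde{\mathcal M}$ of $M$ new items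 each. 1. During the first $\lceil 2Mr/N\rceil$ steps recommend each item of $\mathcal M\cup\widetilde{\mathcal M}$ to $r$ users, according to any random assignment, independent of the model, for which the set of users of each single item is uniform among the $r$-subsets of $[N]$ and no user gets an item twice; the remaining slots are filled with new items. 2. For $j=1,\dots,\ell$, as long as $\widetilde{\mathcal M}\ne\varnothing$: draw $\mathrm{rep}_j$ uniformly from $\widetilde{\mathcal M}$, independently of the past, and spend one step recommending it to all users that have not rated it (the other users get a new item). Let $\mathcal S^1_j$ and $\mathcal S^2_j$ be the sets of items $i$ in $\mathcal M$ and in $\widetilde{\mathcal M}$ respectively such that all users that have rated both $i$ and $\mathrm{rep}_j$ rated them alike, and remove $\mathcal S^1_j$ from $\mathcal M$ and $\mathcal S^2_j$ from $\widetilde{\mathcal M}$. 3. Let $\mathcal R_u=\bigcup_{j:\,L_{u,\mathrm{rep}_j}=+1}\mathcal S^1_j$. In every remaining step up to time $T$ recommend to $u$ an item of $\mathcal R_u$ that $u$ has not yet rated (selected by any rule based on the past), or a new item if there is none. **Theorem.** Let $T\ge 1$, $q_I>13\log N$ and $4r<q_U\le N$, and let $$Y(T)=4+\max\Big\{52\log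 T,\;48\sqrt{\tfrac{q_I r}{N}T},\;270\,\tfrac rN T\Big\}.$$ Then Item-Item has $\mathrm{regret}(T)<Y(T)$. Consequently, the algorithm that runs Item-Item if $Y(T)\le T/2$, and otherwise the trivial algorithm that recommends a new item at every step independently of all feedback, has $\mathrm{regret}(T)\le\min\{Y(T),T/2\}$. -/

import Mathlib

open MeasureTheory
open scoped ENNReal

noncomputable section

namespace ItemItemCF

/-! ### The recommendation model -/

/-- The latent variables: the preference matrix (rows are user types, columns are item types,
`true` means "like", i.e. `+1`), the user types, and the types of the infinitely many items. -/
abbrev Env (N qU qI : ℕ) : Type :=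
  (Fin qU → Fin qI → Bool) × (Fin N → Fin qU) × (ℕ → Fin qI)

/-- The uniform distribution on a finite type. -/
def unif (α : Type) [Fintype α] [Nonempty α] [MeasurableSpace α] : Measure α :=
  (PMF.uniformOfFintype α).toMeasure

instance (α : Type) [Fintype α] [Nonempty α] [MeasurableSpace α] :
    IsProbabilityMeasure (unif α) := by
  unfold unif; infer_instance

/-- Entries of the preference matrix i.i.d. fair, user types i.i.d. uniform on the `qU` user
types, item types i.i.d. uniform on the `qI` item types, all jointly independent. -/
def envLaw (N qU qI : ℕ) [NeZero qU] [NeZero qI] : Measure (Env N qU qI) :=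
  (Measure.pi fun _ : Fin qU => Measure.pi fun _ : Fin qI => unif Bool).prod
    ((Measure.pi fun _ : Fin N => unif (Fin qU)).prod
      (Measure.infinitePi fun _ : ℕ => unif (Fin qI)))

/-- The rating of item `i` by user `u`: `ξ_{τ_U(u), τ_I(i)}`. -/
def rating {N qU qI : ℕ} (ω : Env N qU qI) (u : Fin N) (i : ℕ) : Bool :=
  ω.1 (ω.2.1 u) (ω.2.2 i)

/-- What has been seen so far: one entry per elapsed time step, latest first; an entry tells, for
each user, which item was recommended and how it was rated. -/
abbrev History (N : ℕ) : Type := List (Fin N → ℕ × Bool)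

/-- A recommendation rule: the next item for each user as a function of the past. A randomized
algorithm is a rule that depends in addition on a random seed. -/
abbrev Policy (N : ℕ) : Type := History N → Fin N → ℕ

/-- The history after `t` time steps, when the true ratings are `L`. -/
def history {N : ℕ} (L : Fin N → ℕ → Bool) (A : Policy N) : ℕ → History N
  | 0 => []
  | t + 1 => (fun u => (A (history L A t) u, L u (A (history L A t) u))) :: history L A t

/-- Number of disliked recommendations per user in the first `T` time steps. -/
def loss {N : ℕ} (L : Fin N → ℕ → Bool) (A : Policy N) (T : ℕ) : ℝ :=
  ∑ t ∈ Finset.range T, (1 / (N : ℝ)) *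
    ∑ u : Fin N, if L u (A (history L A t) u) = false then (1 : ℝ) else 0

/-- Expected number of disliked recommendations per user in the first `T` time steps. The
expectation is over the model and over the seed `z` of the algorithm, of law `ζ`, which is
independent of the model. -/
def regret (N qU qI : ℕ) [NeZero qU] [NeZero qI] {Z : Type} [Fintype Z] (ζ : PMF Z)
    (A : Z → Policy N) (T : ℕ) : ℝ :=
  ∑ z : Z, (ζ z).toReal * ∫ ω, loss (rating ω) (A z) T ∂(envLaw N qU qI)

/-! ### Parameters of the algorithm -/

/-- Number of users that rate each item in the preliminary exploration. -/
def rParam (N qI : ℕ) : ℕ :=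
  ⌈2 * Real.logb 2 (2 * (N : ℝ) * (qI : ℝ) ^ 2)⌉₊

/-- Number of item types to be explored. -/
def ellParam (T qI N : ℕ) : ℕ :=
  min ⌈18 * Real.logb 2 T + Real.sqrt (330 * ((qI : ℝ) * rParam N qI / N) * T)⌉₊ qI

/-- Number of items in each of the two item sets. -/
def MParam (T qI N : ℕ) : ℕ :=
  ⌈64 * (qI : ℝ) / ellParam T qI N * T⌉₊

/-- Number of time steps of the preliminary exploration. -/
def prelimTime (N M r : ℕ) : ℕ :=
  ⌈2 * (M : ℝ) * r / N⌉₊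

/-! ### The preliminary exploration

The items are exchangeable, so "new random items" are just items with labels not used before: the
first item set `𝓜` has labels `0, …, M-1`, the second item set `𝓜̃` has labels `M, …, 2M-1`, and
every other new item has a label `≥ 2M`. -/

/-- A plan for `P` time steps: at step `s`, user `u` is recommended item `k < 2M` if the plan
shows `some k`, and a new random item if it shows `none`. -/
abbrev Plan (N M P : ℕ) : Type := Fin P → Fin N → Option (Fin (2 * M))

/-- The users to whom the plan recommends item `k`. -/
def Plan.users {N M P : ℕ} (S : Plan N M P) (k : Fin (2 * M)) : Finset (Fin N) :=
  Finset.univ.filter fun u => ∃ s, S s u = some k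

/-- A random plan in which no user meets an item twice, and in which the set of users of each
single item is uniformly random among all sets of `r` users (nothing is required of the joint law
for several items). -/
structure IsUniformPlan {N M P : ℕ} (r : ℕ) (ν : PMF (Plan N M P)) : Prop where
  once : ∀ S ∈ ν.support, ∀ u s s' k, S s u = some k → S s' u = some k → s = s'
  uniform : ∀ (k : Fin (2 * M)) (U : Finset (Fin N)), U.card = r →
    ν.map (fun S => S.users k) U = ((N.choose r : ℕ) : ℝ≥0∞)⁻¹

/-- The plan obtained by running repeatedly through the users in the order `σ` and giving to each
item a block of `r` consecutive users. -/
def permPlan (N M P r : ℕ) (σ : Equiv.Perm (Fin N)) : Plan N M P := fun s u =>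
  if hk : ((s : ℕ) * N + (σ.symm u : ℕ)) / r < 2 * M then some ⟨_, hk⟩ else none

/-- With a uniformly random order of the users, the block plan is admissible. -/
theorem exists_isUniformPlan (N M r : ℕ) (hr : 0 < r) (hrN : r ≤ N) :
    ∃ ν : PMF (Plan N M (prelimTime N M r)), IsUniformPlan r ν := by
  classical
  have hN : 0 < N := by omega
  set P := prelimTime N M r with hP
  have hPN : 2 * M * r ≤ P * N := by
    have h1 : 2 * (M : ℝ) * r / N ≤ P := by rw [hP]; exact Nat.le_ceil _
    have hN' : (0 : ℝ) < N := by exact_mod_cast hN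
    rw [div_le_iff₀ hN'] at h1
    exact_mod_cast h1
  refine ⟨(PMF.uniformOfFintype (Equiv.Perm (Fin N))).map (permPlan N M P r), ?_, ?_⟩
  · intro S hS u s s' k h1 h2
    rw [PMF.support_map] at hS
    obtain ⟨σ, -, rfl⟩ := hS
    unfold permPlan at h1 h2
    split_ifs at h1 h2 with g1 g2
    simp only [Option.some.injEq, Fin.ext_iff] at h1 h2
    have a1 := Nat.div_add_mod ((s : ℕ) * N + (σ.symm u : ℕ)) r
    have a2 := Nat.div_add_mod ((s' : ℕ) * N + (σ.symm u : ℕ)) r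
    have b1 := Nat.mod_lt ((s : ℕ) * N + (σ.symm u : ℕ)) hr
    have b2 := Nat.mod_lt ((s' : ℕ) * N + (σ.symm u : ℕ)) hr
    rw [h1] at a1
    rw [h2] at a2
    apply Fin.ext
    by_contra hne
    rcases Nat.lt_or_gt_of_ne hne with h | h
    · have := Nat.mul_le_mul_right N (Nat.succ_le_of_lt h)
      rw [Nat.succ_mul] at this
      omega
    · have := Nat.mul_le_mul_right N (Nat.succ_le_of_lt h)
      rw [Nat.succ_mul] at this
      omega
  · intro k U hU
    -- the positions of the block of item `k`, as a set of `r` residues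
    let f : Fin r → Fin N := fun m => ⟨((k : ℕ) * r + m) % N, Nat.mod_lt _ hN⟩
    have hf : Function.Injective f := by
      intro m m' h
      simp only [f, Fin.mk.injEq] at h
      have h' : (m : ℕ) ≡ m' [MOD N] := Nat.ModEq.add_left_cancel' _ h
      exact Fin.ext (Nat.ModEq.eq_of_lt_of_lt h' (by omega) (by omega))
    let W : Finset (Fin N) := Finset.univ.image f
    have hW : W.card = r := by
      rw [Finset.card_image_of_injective _ hf]; simp
    have husers : ∀ σ : Equiv.Perm (Fin N), (permPlan N M P r σ).users k = W.map σ.toEmbedding := by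
      intro σ
      ext u
      have hmem : u ∈ (permPlan N M P r σ).users k ↔ ∃ s, permPlan N M P r σ s u = some k := by
        simp [Plan.users]
      rw [hmem]
      simp only [permPlan, Finset.mem_univ, true_and, Finset.mem_map_equiv, W, Finset.mem_image, f]
      constructor
      · rintro ⟨s, hs⟩
        split_ifs at hs with g
        simp only [Option.some.injEq, Fin.ext_iff] at hs
        have a1 := Nat.div_add_mod ((s : ℕ) * N + (σ.symm u : ℕ)) r
        have b1 := Nat.mod_lt ((s : ℕ) * N + (σ.symm u : ℕ)) hr
        rw [hs] at a1
        refine ⟨⟨_, b1⟩, ?_⟩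
        apply Fin.ext
        simp only
        rw [mul_comm (k : ℕ) r, a1, mul_comm (s : ℕ) N, Nat.mul_add_mod, Nat.mod_eq_of_lt (σ.symm u).2]
      · rintro ⟨m, hm⟩
        have hm' : ((k : ℕ) * r + m) % N = (σ.symm u : ℕ) := congrArg Fin.val hm
        have a1 := Nat.div_add_mod ((k : ℕ) * r + m) N
        have hlt : (k : ℕ) * r + m < P * N := by
          have := Nat.mul_le_mul_right r (Nat.succ_le_of_lt k.2)
          rw [Nat.succ_mul] at this
          omega
        have hdiv : ((k : ℕ) * r + m) / N < P := (Nat.div_lt_iff_lt_mul hN).2 hlt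
        have e : ((k : ℕ) * r + m) / N * N + (σ.symm u : ℕ) = k * r + m := by
          rw [← hm', mul_comm]; exact a1
        have e2 : ((k : ℕ) * r + m) / r = k := by
          rw [mul_comm, Nat.mul_add_div hr, Nat.div_eq_of_lt m.2, add_zero]
        refine ⟨⟨_, hdiv⟩, ?_⟩
        simp only [e, e2]
        rw [dif_pos k.2]
    rw [PMF.map_comp]
    have hcomp : ((fun S : Plan N M P => S.users k) ∘ permPlan N M P r)
        = fun σ : Equiv.Perm (Fin N) => W.map σ.toEmbedding := funext husers
    rw [hcomp]
    set q := (PMF.uniformOfFintype (Equiv.Perm (Fin N))).map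
      (fun σ : Equiv.Perm (Fin N) => W.map σ.toEmbedding) with hq
    have hval : ∀ V, q V = ((Finset.univ.filter
        fun σ : Equiv.Perm (Fin N) => V = W.map σ.toEmbedding).card : ℝ≥0∞)
          * ((Fintype.card (Equiv.Perm (Fin N)) : ℕ) : ℝ≥0∞)⁻¹ := by
      intro V
      rw [hq, PMF.map_apply, tsum_fintype]
      simp only [PMF.uniformOfFintype_apply]
      rw [← Finset.sum_filter, Finset.sum_const, nsmul_eq_mul]
    have hsame : ∀ V V' : Finset (Fin N), V.card = r → V'.card = r → q V = q V' := by
      intro V V' hV hV'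
      have e : {x // x ∈ V} ≃ {x // x ∈ V'} := Fintype.equivOfCardEq (by simp [hV, hV'])
      let τ : Equiv.Perm (Fin N) := e.extendSubtype
      have hτ : V.map τ.toEmbedding = V' := by
        apply Finset.eq_of_subset_of_card_le
        · intro y hy
          rw [Finset.mem_map] at hy
          obtain ⟨x, hx, rfl⟩ := hy
          exact e.extendSubtype_mem x hx
        · rw [Finset.card_map, hV, hV']
      rw [hval, hval]
      congr 2
      apply Finset.card_equiv (Equiv.mulLeft τ)
      intro σ
      simp only [Finset.mem_filter, Finset.mem_univ, true_and, Equiv.coe_mulLeft]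
      have hm : W.map (τ * σ).toEmbedding = (W.map σ.toEmbedding).map τ.toEmbedding := by
        rw [Finset.map_map]; rfl
      rw [hm, ← hτ]
      exact ⟨fun h => by rw [h], fun h => Finset.map_injective _ h⟩
    have hzero : ∀ V : Finset (Fin N), V.card ≠ r → q V = 0 := by
      intro V hV
      rw [hval, Finset.filter_false_of_mem]
      · simp
      · rintro σ - h
        apply hV
        rw [h, Finset.card_map, hW]
    have hsum : ∑ V ∈ Finset.powersetCard r (Finset.univ : Finset (Fin N)), q V = 1 := by
      rw [← q.tsum_coe, tsum_fintype]
      apply Finset.sum_subset (Finset.subset_univ _)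
      intro V _ hV
      apply hzero
      intro h
      exact hV (Finset.mem_powersetCard.2 ⟨Finset.subset_univ _, h⟩)
    rw [Finset.sum_congr rfl (fun V hV => hsame V U (Finset.mem_powersetCard.1 hV).2 hU),
      Finset.sum_const, Finset.card_powersetCard, Finset.card_univ, Fintype.card_fin,
      nsmul_eq_mul] at hsum
    exact ENNReal.eq_inv_of_mul_eq_one_left (by rw [mul_comm]; exact hsum)

/-! ### The algorithm -/

/-- User `u` has already rated item `i`. -/
def Rated {N : ℕ} (h : History N) (u : Fin N) (i : ℕ) : Prop :=
  ∃ e ∈ h, (e u).1 = i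

/-- User `u` has already rated item `i`, and liked it. -/
def Liked {N : ℕ} (h : History N) (u : Fin N) (i : ℕ) : Prop :=
  ∃ e ∈ h, e u = (i, true)

/-- All users that have rated both `i` and `j` gave them the same rating. -/
def Agree {N : ℕ} (h : History N) (i j : ℕ) : Prop :=
  ∀ u, ∀ e ∈ h, ∀ e' ∈ h, (e u).1 = i → (e' u).1 = j → (e u).2 = (e' u).2

/-- Memory of the algorithm: what is left of the two item sets `𝓜` and `𝓜̃`, the number of
representatives used so far, and the sets `𝓡_u` of exploitable items. -/
structure Memory (N : ℕ) where
  M₁ : Finset ℕ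
  M₂ : Finset ℕ
  reps : ℕ
  R : Fin N → Finset ℕ

/-- The next representative, a uniformly random remaining item of `𝓜̃` (`none` if the loop over
representatives is over, either because `ℓ` of them have been used or because `𝓜̃` is empty).
The draws are made by going through the items of `𝓜̃` in a uniformly random order `π`, fixed
beforehand: given the past, the first item in this order that remains is uniform on the remaining
ones. -/
def nextRep {N M : ℕ} (ℓ : ℕ) (π : Equiv.Perm (Fin M)) (m : Memory N) : Option ℕ :=
  if m.reps < ℓ then
    (List.ofFn fun k : Fin M => M + (π k : ℕ)).find? fun i => decide (i ∈ m.M₂)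
  else none

open Classical in
/-- One pass of the loop, after all users have rated the representative `ρ`; the history `h`
includes these ratings. -/
def absorbRep {N : ℕ} (h : History N) (ρ : ℕ) (m : Memory N) : Memory N where
  M₁ := m.M₁.filter fun i => ¬ Agree h i ρ
  M₂ := m.M₂.filter fun i => ¬ Agree h i ρ
  reps := m.reps + 1
  R := fun u => if Liked h u ρ then m.R u ∪ m.M₁.filter (fun i => Agree h i ρ) else m.R u

/-- The memory as a function of the history. Nothing is done in the first `P` time steps
(preliminary exploration), nor after the loop over representatives is over. -/
def memory {N M : ℕ} (ℓ P : ℕ) (π : Equiv.Perm (Fin M)) : History N → Memory N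
  | [] => ⟨Finset.range M, Finset.Ico M (2 * M), 0, fun _ => ∅⟩
  | e :: h =>
    if h.length < P then memory ℓ P π h
    else match nextRep ℓ π (memory ℓ P π h) with
      | some ρ => absorbRep (e :: h) ρ (memory ℓ P π h)
      | none => memory ℓ P π h

/-- A new random item for user `u` at time `t`. -/
def freshItem {N : ℕ} (M t : ℕ) (u : Fin N) : ℕ := 2 * M + (t * N + u)

open Classical in
/-- The algorithm, given the plan `S` of the preliminary exploration, the random order `π`, and
the rule `pick` that selects an item among the exploitable items not yet rated by the user:
first follow the plan; then show representatives to all users; then exploit. -/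
def itemItemPolicy {N M P : ℕ} (ℓ : ℕ) (pick : History N → Fin N → Finset ℕ → ℕ)
    (S : Plan N M P) (π : Equiv.Perm (Fin M)) : Policy N := fun h u =>
  if hP : h.length < P then
    match S ⟨h.length, hP⟩ u with
    | some k => k
    | none => freshItem M h.length u
  else
    match nextRep ℓ π (memory ℓ P π h) with
    | some ρ => if Rated h u ρ then freshItem M h.length u else ρ
    | none =>
      if (((memory ℓ P π h).R u).filter fun i => ¬ Rated h u i).Nonempty then
        pick h u (((memory ℓ P π h).R u).filter fun i => ¬ Rated h u i)
      else freshItem M h.length u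

/-- The plans used by `Item-Item` with inputs `T`, `qI`, `N`. -/
abbrev IIPlan (T qI N : ℕ) : Type :=
  Plan N (MParam T qI N) (prelimTime N (MParam T qI N) (rParam N qI))

/-- The seeds of `Item-Item`: a plan and an order of the second item set. -/
abbrev IISeed (T qI N : ℕ) : Type :=
  IIPlan T qI N × Equiv.Perm (Fin (MParam T qI N))

/-- The law of the seed: a plan of law `ν` and an independent uniformly random order. -/
def seedLaw {T qI N : ℕ} (ν : PMF (IIPlan T qI N)) : PMF (IISeed T qI N) :=
  ν.bind fun S => (PMF.uniformOfFintype (Equiv.Perm (Fin (MParam T qI N)))).map fun π => (S, π)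

/-- `Item-Item` with inputs `T`, `qI`, `N`. -/
def itemItem (T qI N : ℕ) (pick : History N → Fin N → Finset ℕ → ℕ) (z : IISeed T qI N) :
    Policy N :=
  itemItemPolicy (ellParam T qI N) pick z.1 z.2

/-- The trivial algorithm: a new item, the same for all users, at each time step. -/
def trivialPolicy (N : ℕ) : Policy N := fun h _ => h.length

/-- The function `Y(T)` of the regret bound. -/
def Ybound (N qI T : ℕ) : ℝ :=
  4 + max (52 * Real.logb 2 T)
    (max (48 * Real.sqrt ((qI : ℝ) * rParam N qI / N * T)) (270 * ((rParam N qI : ℝ) / N) * T))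

/-- `Item-Item` if `Y(T) ≤ T/2`, the trivial algorithm otherwise. -/
def itemItemOrTrivial (T qI N : ℕ) (pick : History N → Fin N → Finset ℕ → ℕ)
    (z : IISeed T qI N) : Policy N :=
  if Ybound N qI T ≤ (T : ℝ) / 2 then itemItem T qI N pick z else trivialPolicy N

end ItemItemCF

end

/-! Fix the seed, that is, the plan and the order of the second item set. Call an item clear if the
`r` users who rate it in the plan distinguish it from all items of other types. An item is compared
with a representative on at least these users, and items of equal type always agree, so for clear
items the comparison is exact. This gives a deterministic bound (`card_disliked_le`): a user
dislikes at most `P + ℓ` recommendations made by the plan and for the representatives, at most one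
per unclear item of the first set, and up to `T` more only in case of a shortage. A shortage means
that fewer than `T` clear items of the first set have a type that the user likes and that also
belongs to a clear item among the first `ℓ` of the second set.

The rest is a computation with finitely many independent uniform variables, mostly Markov's
inequality for exponential moments. Two types agree on `r` users with probability at most `(5/8)^r`,
so confusion is rare (`expect_confusable_le`). The first `ℓ` items of the second set show more than
`3ℓ/32` distinct liked types, except with probability `2^(-ℓ/10)` (`expect_distinct_liked_le`,
`rpow_mul_pow_le`). Unless `ℓ/32` of these items are confusable, at least `ℓ/16` types are covered,
and then `M ≥ 64 qI T/ℓ` items include more than `2T` of covered types, except with probability `4^T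
e^(-2T)` (`expect_mem_pow`). The pointwise inequality `shortage_le` merges these events, and
`expect_exploitLoss_le` averages it.

If `T < Y(T)` the bound is trivial. Otherwise `seed_bound_lt_Ybound` adds up the terms; the value of
`ℓ` balances the cost `ℓ` of the representatives against the cost of about `128 qI r T/(N ℓ)` of the
plan. The trivial algorithm loses exactly `T/2`. -/

open scoped BigOperators

namespace ItemItemCF

/-! ### Averages over finite product spaces -/

section Averages

variable {ι α : Type*} [Fintype ι] [DecidableEq ι] [Fintype α] [Nonempty α]

/-- Resampling one coordinate does not change the average. -/
theorem expect_resample (f : (ι → α) → ℝ) (u : ι) :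
    𝔼 τ, f τ = 𝔼 τ, 𝔼 c, f (Function.update τ u c) := by
  have h1 : 𝔼 τ : ι → α, f τ = 𝔼 τ : ι → α, 𝔼 _c : α, f τ := by
    simp only [Fintype.expect_const]
  rw [h1, ← Finset.expect_product', ← Finset.expect_product']
  -- Exchanging the coordinate `u` of the point with the fresh value is an involution on pairs.
  refine Finset.expect_nbij' (fun p => (Function.update p.1 u p.2, p.1 u))
    (fun p => (Function.update p.1 u p.2, p.1 u)) ?_ ?_ ?_ ?_ ?_ <;> simp

theorem expect_mono {β : Type*} [Fintype β] {f g : β → ℝ} (h : ∀ x, f x ≤ g x) :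
    𝔼 x, f x ≤ 𝔼 x, g x :=
  Finset.expect_le_expect fun x _ => h x

/-- The average of a product over independent coordinates. -/
theorem expect_prod_coord (U : Finset ι) (f : ι → α → ℝ) :
    𝔼 τ : ι → α, ∏ i ∈ U, f i (τ i) = ∏ i ∈ U, 𝔼 c, f i c := by
  induction U using Finset.induction_on with
  | empty => simp
  | insert u U hu ih =>
    rw [expect_resample _ u, Finset.prod_insert hu, ← ih, Finset.mul_expect]
    refine Finset.expect_congr rfl fun τ _ => ?_
    rw [Finset.expect_mul]
    refine Finset.expect_congr rfl fun c _ => ?_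
    rw [Finset.prod_insert hu, Function.update_self]
    congr 1
    refine Finset.prod_congr rfl fun i hi => ?_
    rw [Function.update_of_ne (ne_of_mem_of_not_mem hi hu)]

/-- The average of a function with two values. -/
theorem expect_ite_mem_const [DecidableEq α] (A : Finset α) (x y : ℝ) :
    𝔼 c : α, (if c ∈ A then x else y)
      = y + (x - y) * (A.card / Fintype.card α) := by
  have h0 : (Fintype.card α : ℝ) ≠ 0 := by exact_mod_cast Fintype.card_ne_zero
  have h : ∀ c : α, (if c ∈ A then x else y) = y + (if c ∈ A then x - y else 0) := by
    intro c; split_ifs <;> ring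
  simp only [h]
  rw [Finset.expect_add_distrib, Fintype.expect_const, Fintype.expect_eq_sum_div_card]
  rw [Finset.sum_ite_mem, Finset.univ_inter, Finset.sum_const, nsmul_eq_mul]
  ring

/-- Exponential moment of the number of distinct values among independent uniform draws. -/
theorem expect_pow_card_image_le [DecidableEq α] {y : ℝ} (hy0 : 0 ≤ y) (hy1 : y ≤ 1)
    (U : Finset ι) :
    𝔼 τ : ι → α, y ^ (U.image τ).card
      ≤ ∏ k ∈ Finset.range U.card, (y + (1 - y) * (k / Fintype.card α)) := by
  have hq : (0 : ℝ) < Fintype.card α := by exact_mod_cast Fintype.card_pos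
  induction U using Finset.induction_on with
  | empty => simp
  | insert u U hu ih =>
    rw [Finset.card_insert_of_notMem hu, Finset.prod_range_succ]
    have hf : 0 ≤ y + (1 - y) * (U.card / Fintype.card α) := by
      have : 0 ≤ 1 - y := by linarith
      positivity
    refine le_trans ?_ (mul_le_mul_of_nonneg_right ih hf)
    rw [expect_resample _ u, Finset.expect_mul]
    refine expect_mono fun τ => ?_
    have him : ∀ c, U.image (Function.update τ u c) = U.image τ := by
      intro c
      refine Finset.image_congr fun i hi => ?_
      exact Function.update_of_ne (ne_of_mem_of_not_mem hi hu) _ _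
    -- A new draw contributes a factor `y` unless it hits one of the values already seen, of which
    -- there are at most `U.card`.
    have hval : ∀ c, y ^ ((insert u U).image (Function.update τ u c)).card
        = y ^ (U.image τ).card * (if c ∈ U.image τ then 1 else y) := by
      intro c
      rw [Finset.image_insert, him, Function.update_self]
      split_ifs with hc
      · rw [Finset.insert_eq_of_mem hc, mul_one]
      · rw [Finset.card_insert_of_notMem hc, pow_succ]
    simp only [hval]
    rw [← Finset.mul_expect, expect_ite_mem_const]
    have hc : ((U.image τ).card : ℝ) ≤ U.card := by exact_mod_cast Finset.card_image_le
    have h1y : 0 ≤ 1 - y := by linarith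
    gcongr

end Averages

/-- The product of an arithmetic progression is at most a power of its mean. -/
theorem prod_arith_le {y c : ℝ} (hy : 0 < y) (hc : 0 ≤ c) (m : ℕ) :
    ∏ k ∈ Finset.range m, (y + c * k) ≤ (y + c * m / 2) ^ m := by
  induction m with
  | zero => simp
  | succ m ih =>
    rw [Finset.prod_range_succ]
    have h0 : 0 < y + c * m / 2 := by positivity
    have h1 : 0 ≤ y + c * m := by positivity
    refine (mul_le_mul_of_nonneg_right ih h1).trans ?_
    set B := y + c * m / 2 with hB
    have e : y + c * ((m + 1 : ℕ) : ℝ) / 2 = B * (1 + c / 2 / B) := by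
      field_simp; push_cast; rw [hB]; ring
    -- Passing from `m` to `m + 1` raises the mean `B` by `c/2`; Bernoulli's inequality for `(1 +
    -- (c/2)/B)^(m+1)` pays for the new factor.
    have hber := one_add_mul_le_pow (a := c / 2 / B)
      (by have : 0 ≤ c / 2 / B := by positivity
          linarith) (m + 1)
    rw [e, mul_pow]
    calc B ^ m * (y + c * m) ≤ B ^ (m + 1) * (1 + ((m + 1 : ℕ) : ℝ) * (c / 2 / B)) := by
          rw [pow_succ, mul_assoc]
          apply mul_le_mul_of_nonneg_left _ (by positivity)
          have : B * (1 + ((m + 1 : ℕ) : ℝ) * (c / 2 / B)) = B + (m + 1) * (c / 2) := by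
            field_simp; push_cast; ring
          rw [this, hB]; nlinarith
      _ ≤ _ := mul_le_mul_of_nonneg_left hber (by positivity)

/-! ### The law of finitely many latent variables -/

theorem unif_singleton {α : Type} [Fintype α] [Nonempty α] [MeasurableSpace α]
    [MeasurableSingletonClass α] (a : α) : unif α {a} = (Fintype.card α : ℝ≥0∞)⁻¹ := by
  rw [unif, PMF.toMeasure_apply_singleton _ _ (measurableSet_singleton a),
    PMF.uniformOfFintype_apply]

/-- A measure on a finite type that gives the same mass to all points integrates functions to
their averages. -/
theorem integral_eq_expect {α : Type*} [Fintype α] [MeasurableSpace α]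
    [MeasurableSingletonClass α] (μ : Measure α) [IsFiniteMeasure μ]
    (h : ∀ a, μ {a} = (Fintype.card α : ℝ≥0∞)⁻¹) (f : α → ℝ) : ∫ a, f a ∂μ = 𝔼 a, f a := by
  rw [integral_fintype (Integrable.of_finite), Fintype.expect_eq_sum_div_card, Finset.sum_div]
  refine Finset.sum_congr rfl fun a _ => ?_
  rw [measureReal_def, h, ENNReal.toReal_inv, ENNReal.toReal_natCast, smul_eq_mul]
  ring

/-- The latent variables that matter when only the items `f i` are considered. -/
def Env.restrict {N qU qI : ℕ} {ι : Type} (f : ι → ℕ) (ω : Env N qU qI) :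
    (Fin qU → Fin qI → Bool) × (Fin N → Fin qU) × (ι → Fin qI) :=
  (ω.1, ω.2.1, fun i => ω.2.2 (f i))

theorem measurable_restrict {N qU qI : ℕ} {ι : Type} (f : ι → ℕ) :
    Measurable (Env.restrict f : Env N qU qI → _) := by
  unfold Env.restrict
  fun_prop

instance (N qU qI : ℕ) [NeZero qU] [NeZero qI] : IsProbabilityMeasure (envLaw N qU qI) := by
  unfold envLaw; infer_instance

/-- Injectivity makes the items `f i` distinct coordinates of the infinite product, so the preimage
of a point is a cylinder whose mass is a product. -/
theorem envLaw_map_restrict_singleton {N qU qI : ℕ} [NeZero qU] [NeZero qI] {ι : Type}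
    [Fintype ι] [DecidableEq ι] {f : ι → ℕ} (hf : Function.Injective f)
    (x : (Fin qU → Fin qI → Bool) × (Fin N → Fin qU) × (ι → Fin qI)) :
    (envLaw N qU qI).map (Env.restrict f) {x}
      = (Fintype.card ((Fin qU → Fin qI → Bool) × (Fin N → Fin qU) × (ι → Fin qI)) : ℝ≥0∞)⁻¹ := by
  rw [Measure.map_apply (measurable_restrict f) (measurableSet_singleton x)]
  obtain ⟨ξ, σ, τ⟩ := x
  -- The default value `0` is irrelevant: the cylinder constrains only labels in the range of `f`.
  have hτ : ∀ i, Function.extend f τ 0 (f i) = τ i := fun i => hf.extend_apply τ 0 i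
  have hpre : Env.restrict f ⁻¹' {(ξ, σ, τ)} = {ξ} ×ˢ ({σ} ×ˢ
      (Set.pi ((Finset.univ.image f : Finset ℕ) : Set ℕ)
        fun n => ({Function.extend f τ 0 n} : Set (Fin qI)))) := by
    ext ω
    simp only [Env.restrict, Set.mem_preimage, Set.mem_singleton_iff, Prod.mk.injEq, Set.mem_prod,
      Set.mem_pi, Finset.coe_image, Finset.coe_univ, Set.image_univ, Set.mem_range,
      forall_exists_index, forall_apply_eq_imp_iff, hτ, funext_iff (f := fun i => ω.2.2 (f i))]
  rw [hpre, envLaw, Measure.prod_prod, Measure.prod_prod, Measure.infinitePi_pi _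
    (fun _ _ => measurableSet_singleton _), Measure.pi_singleton, Measure.pi_singleton]
  simp only [Measure.pi_singleton, unif_singleton, Finset.prod_const, Finset.card_univ,
    Fintype.card_fin, Fintype.card_prod, Fintype.card_fun, Fintype.card_bool,
    Finset.card_image_of_injective _ hf, Nat.cast_mul, Nat.cast_pow]
  have h1 : ((qI : ℝ≥0∞)) ≠ 0 := by exact_mod_cast NeZero.ne qI
  have h2 : ((qU : ℝ≥0∞)) ≠ 0 := by exact_mod_cast NeZero.ne qU
  have h3 : ((qI : ℝ≥0∞)) ≠ ⊤ := ENNReal.natCast_ne_top _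
  have h4 : ((qU : ℝ≥0∞)) ≠ ⊤ := ENNReal.natCast_ne_top _
  rw [ENNReal.mul_inv (Or.inr (by finiteness)) (Or.inr (by positivity)),
    ENNReal.mul_inv (Or.inr (by finiteness)) (Or.inr (by positivity)),
    ENNReal.inv_pow, ENNReal.inv_pow, ENNReal.inv_pow, ENNReal.inv_pow]

/-- Functions of finitely many latent variables are integrated by averaging. -/
theorem integral_envLaw {N qU qI : ℕ} [NeZero qU] [NeZero qI] {ι : Type}
    [Fintype ι] [DecidableEq ι] {f : ι → ℕ} (hf : Function.Injective f)
    (g : (Fin qU → Fin qI → Bool) → (Fin N → Fin qU) → (ι → Fin qI) → ℝ) :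
    Integrable (fun ω => g ω.1 ω.2.1 fun i => ω.2.2 (f i)) (envLaw N qU qI) ∧
    ∫ ω, g ω.1 ω.2.1 (fun i => ω.2.2 (f i)) ∂(envLaw N qU qI)
      = 𝔼 ξ, 𝔼 σ, 𝔼 τ, g ξ σ τ := by
  let G : (Fin qU → Fin qI → Bool) × (Fin N → Fin qU) × (ι → Fin qI) → ℝ :=
    fun x => g x.1 x.2.1 x.2.2
  have hG : Measurable G := measurable_of_finite G
  have : IsProbabilityMeasure ((envLaw N qU qI).map (Env.restrict f)) :=
    Measure.isProbabilityMeasure_map (measurable_restrict f).aemeasurable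
  constructor
  · exact (Integrable.of_finite (f := G) (μ := (envLaw N qU qI).map (Env.restrict f))).comp_measurable
      (measurable_restrict f)
  · have h := integral_map (μ := envLaw N qU qI) (measurable_restrict f).aemeasurable
      hG.aestronglyMeasurable
    rw [integral_eq_expect _ (envLaw_map_restrict_singleton hf)] at h
    refine h.symm.trans ?_
    rw [← Finset.univ_product_univ, Finset.expect_product]
    refine Finset.expect_congr rfl fun ξ _ => ?_
    rw [← Finset.univ_product_univ, Finset.expect_product]

/-- The same for two blocks of items. -/
theorem integral_envLaw_sum {N qU qI : ℕ} [NeZero qU] [NeZero qI] {ι κ : Type}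
    [Fintype ι] [DecidableEq ι] [Fintype κ] [DecidableEq κ] {f : ι → ℕ} {f' : κ → ℕ}
    (hf : Function.Injective f) (hf' : Function.Injective f') (hff : ∀ i k, f i ≠ f' k)
    (g : (Fin qU → Fin qI → Bool) → (Fin N → Fin qU) → (ι → Fin qI) → (κ → Fin qI) → ℝ) :
    Integrable (fun ω => g ω.1 ω.2.1 (fun i => ω.2.2 (f i)) (fun k => ω.2.2 (f' k)))
      (envLaw N qU qI) ∧
    ∫ ω, g ω.1 ω.2.1 (fun i => ω.2.2 (f i)) (fun k => ω.2.2 (f' k)) ∂(envLaw N qU qI)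
      = 𝔼 ξ, 𝔼 σ, 𝔼 x, 𝔼 y, g ξ σ x y := by
  have h := integral_envLaw (N := N) (qU := qU) (qI := qI) (hf.sumElim hf' hff)
    (fun ξ σ τ => g ξ σ (fun i => τ (.inl i)) (fun k => τ (.inr k)))
  simp only [Sum.elim_inl, Sum.elim_inr] at h
  refine ⟨h.1, h.2.trans ?_⟩
  refine Finset.expect_congr rfl fun ξ _ => Finset.expect_congr rfl fun σ _ => ?_
  rw [← Finset.expect_product']
  exact Fintype.expect_equiv (Equiv.sumArrowEquivProdArrow ι κ (Fin qI)) _ _ fun τ => rfl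

/-! ### Probability bounds -/

/-- Rows are independent, and in each row resampling the entry at `a` makes it equal to the entry at
`b` with probability `1/2`. -/
theorem expect_agree {q m : ℕ} {a b : Fin m} (hab : a ≠ b) (C : Finset (Fin q)) :
    𝔼 ξ : Fin q → Fin m → Bool, (if ∀ c ∈ C, ξ c a = ξ c b then (1 : ℝ) else 0)
      = (1 / 2) ^ C.card := by
  have h : ∀ ξ : Fin q → Fin m → Bool, (if ∀ c ∈ C, ξ c a = ξ c b then (1 : ℝ) else 0)
      = ∏ c ∈ C, (if ξ c a = ξ c b then (1 : ℝ) else 0) := by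
    intro ξ
    rw [Finset.prod_ite_zero]; simp
  simp only [h]
  rw [expect_prod_coord C (fun _ (w : Fin m → Bool) => if w a = w b then (1 : ℝ) else 0),
    Finset.prod_const]
  congr 1
  rw [expect_resample _ a]
  have h2 : ∀ w : Fin m → Bool, 𝔼 c : Bool, (if Function.update w a c a = Function.update w a c b
      then (1 : ℝ) else 0) = 1 / 2 := by
    intro w
    rw [Fintype.expect_eq_sum_div_card]
    simp only [Function.update_self, Function.update_of_ne hab.symm, Fintype.card_bool]
    cases w b <;> simp
  simp only [h2, Fintype.expect_const]

/-- Each type in `D` contributes an independent factor of mean `(1/4 + 1)/2`. -/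
theorem expect_liked {q m : ℕ} (k : Fin q) (D : Finset (Fin m)) :
    𝔼 ξ : Fin q → Fin m → Bool, (1 / 4 : ℝ) ^ (D.filter fun a => ξ k a = true).card
      = (5 / 8) ^ D.card := by
  have h := expect_prod_coord {k} (fun _ (w : Fin m → Bool) =>
    (1 / 4 : ℝ) ^ (D.filter fun a => w a = true).card)
  simp only [Finset.prod_singleton] at h
  rw [h]
  have h2 : ∀ w : Fin m → Bool, (1 / 4 : ℝ) ^ (D.filter fun a => w a = true).card
      = ∏ a ∈ D, if w a = true then (1 / 4 : ℝ) else 1 := by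
    intro w
    rw [Finset.prod_ite]; simp
  simp only [h2]
  rw [expect_prod_coord D (fun _ (c : Bool) => if c = true then (1 / 4 : ℝ) else 1),
    Finset.prod_const]
  congr 1
  rw [Fintype.expect_eq_sum_div_card]
  simp
  norm_num

/-- The average is the `M`-th power of `1 - |A|/(2q)`. It serves as a lower-tail bound for the
number of items with type in `A`. -/
theorem expect_mem_pow {M q : ℕ} [NeZero q] (A : Finset (Fin q)) :
    𝔼 x : Fin M → Fin q, (1 / 2 : ℝ) ^ (Finset.univ.filter fun i => x i ∈ A).card
      ≤ Real.exp (-(M * A.card / (2 * q))) := by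
  have h2 : ∀ x : Fin M → Fin q, (1 / 2 : ℝ) ^ (Finset.univ.filter fun i => x i ∈ A).card
      = ∏ i, if x i ∈ A then (1 / 2 : ℝ) else 1 := by
    intro w
    rw [Finset.prod_ite]; simp
  simp only [h2]
  rw [expect_prod_coord Finset.univ (fun _ (c : Fin q) => if c ∈ A then (1 / 2 : ℝ) else 1),
    Finset.prod_const, expect_ite_mem_const, Finset.card_univ, Fintype.card_fin, Fintype.card_fin]
  have hq : (0 : ℝ) < q := by exact_mod_cast Nat.pos_of_ne_zero (NeZero.ne q)
  have hA : (A.card : ℝ) / q ≤ 1 := by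
    rw [div_le_one hq]
    exact_mod_cast (Finset.card_le_univ A).trans (by simp)
  have h0 : -(M * A.card / (2 * q) : ℝ) = M * (-(1 / 2 * (A.card / q))) := by field_simp
  rw [h0, Real.exp_nat_mul]
  apply pow_le_pow_left₀ (by linarith)
  have := Real.add_one_le_exp (-(1 / 2 * ((A.card : ℝ) / q)))
  linarith

/-- The users in `U` do not tell the item type `a` from some other type. -/
def Confusable {N qU qI : ℕ} (ξ : Fin qU → Fin qI → Bool) (σ : Fin N → Fin qU)
    (U : Finset (Fin N)) (a : Fin qI) : Prop :=
  ∃ b ≠ a, ∀ v ∈ U, ξ (σ v) a = ξ (σ v) b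

-- Union bound over the other types `b`. For given user types the agreement has probability
-- `2^(-d)`, with `d` the number of distinct types in `U`. Since `4 |U| ≤ qU`, each draw repeats an
-- earlier type with probability at most `1/4`, whence the factor `1/2 + (1/2)(1/4) = 5/8` per user.
open Classical in
theorem expect_confusable_le {N qU qI : ℕ} [NeZero qU] (U : Finset (Fin N))
    (hU : 4 * U.card ≤ qU) (a : Fin qI) :
    𝔼 ξ : Fin qU → Fin qI → Bool, 𝔼 σ : Fin N → Fin qU,
      (if Confusable ξ σ U a then (1 : ℝ) else 0) ≤ qI * (5 / 8) ^ U.card := by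
  have hpt : ∀ (ξ : Fin qU → Fin qI → Bool) (σ : Fin N → Fin qU),
      (if Confusable ξ σ U a then (1 : ℝ) else 0)
        ≤ ∑ b ∈ Finset.univ.filter (· ≠ a),
          (if ∀ c ∈ U.image σ, ξ c a = ξ c b then (1 : ℝ) else 0) := by
    intro ξ σ
    split_ifs with h
    · obtain ⟨b, hb, hv⟩ := h
      refine le_trans ?_ (Finset.single_le_sum (f := fun b =>
        if ∀ c ∈ U.image σ, ξ c a = ξ c b then (1 : ℝ) else 0)
        (fun b _ => by split_ifs <;> norm_num) (a := b) (by simp [hb]))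
      rw [if_pos (by simpa using hv)]
    · exact Finset.sum_nonneg fun b _ => by split_ifs <;> norm_num
  have hq : (0 : ℝ) < qU := by exact_mod_cast Nat.pos_of_ne_zero (NeZero.ne qU)
  have hbound : ∀ b ≠ a, 𝔼 σ : Fin N → Fin qU, 𝔼 ξ : Fin qU → Fin qI → Bool,
      (if ∀ c ∈ U.image σ, ξ c a = ξ c b then (1 : ℝ) else 0) ≤ (5 / 8) ^ U.card := by
    intro b hb
    simp only [expect_agree hb.symm]
    refine (expect_pow_card_image_le (by norm_num) (by norm_num) U).trans ?_
    have hc : (5 / 8 : ℝ) ^ U.card = ∏ _k ∈ Finset.range U.card, (5 / 8 : ℝ) := by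
      rw [Finset.prod_const, Finset.card_range]
    rw [hc]
    refine Finset.prod_le_prod (fun k _ => by positivity) fun k hk => ?_
    have hk' : (4 * k : ℝ) ≤ qU := by
      have := Finset.mem_range.1 hk
      exact_mod_cast (by omega : 4 * k ≤ qU)
    have : (k : ℝ) / qU ≤ 1 / 4 := by rw [div_le_iff₀ hq]; linarith
    rw [Fintype.card_fin]
    linarith
  calc _ ≤ 𝔼 ξ : Fin qU → Fin qI → Bool, 𝔼 σ : Fin N → Fin qU,
        ∑ b ∈ Finset.univ.filter (· ≠ a),
          (if ∀ c ∈ U.image σ, ξ c a = ξ c b then (1 : ℝ) else 0) :=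
        expect_mono fun ξ => expect_mono fun σ => hpt ξ σ
    _ = ∑ b ∈ Finset.univ.filter (· ≠ a), 𝔼 σ : Fin N → Fin qU, 𝔼 ξ : Fin qU → Fin qI → Bool,
          (if ∀ c ∈ U.image σ, ξ c a = ξ c b then (1 : ℝ) else 0) := by
        rw [Finset.expect_comm]
        simp only [Finset.expect_sum_comm]
    _ ≤ ∑ b ∈ Finset.univ.filter (· ≠ a), (5 / 8) ^ U.card :=
        Finset.sum_le_sum fun b hb => hbound b (Finset.mem_filter.1 hb).2
    _ ≤ qI * (5 / 8) ^ U.card := by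
        rw [Finset.sum_const, nsmul_eq_mul]
        gcongr
        exact_mod_cast (Finset.card_le_univ _).trans (by simp)

/-- The first `ℓ` positions. -/
def firstPos (M ℓ : ℕ) : Finset (Fin M) := Finset.univ.filter fun k => (k : ℕ) < ℓ

theorem card_firstPos {M ℓ : ℕ} (h : ℓ ≤ M) : (firstPos M ℓ).card = ℓ := by
  rw [firstPos, Fin.card_filter_val_lt, min_eq_right h]

open Classical in
/-- The item types liked by user `u` that occur, at an item which its users `U k` do not confuse
with any item of another type, among the first `ℓ` items of types `y`. -/
noncomputable def coveredTypes {N qU qI M : ℕ} (ξ : Fin qU → Fin qI → Bool) (σ : Fin N → Fin qU)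
    (U : Fin M → Finset (Fin N)) (y : Fin M → Fin qI) (ℓ : ℕ) (u : Fin N) : Finset (Fin qI) :=
  ((firstPos M ℓ).filter fun k => ¬ Confusable ξ σ (U k) (y k) ∧ ξ (σ u) (y k) = true).image y

/-- Averaging over the preferences turns `1/4` per liked type into `5/8` per distinct type. The
distinct types among `ℓ` draws then give the factors `5/8 + (3/8) k/qI` for `k < ℓ ≤ qI`, of mean at
most `13/16`. -/
theorem expect_distinct_liked_le {N qU qI M ℓ : ℕ} [NeZero qU] [NeZero qI] (hℓM : ℓ ≤ M)
    (hℓ : ℓ ≤ qI) (u : Fin N) :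
    𝔼 ξ : Fin qU → Fin qI → Bool, 𝔼 σ : Fin N → Fin qU, 𝔼 y : Fin M → Fin qI,
      (1 / 4 : ℝ) ^ (((firstPos M ℓ).image y).filter fun a => ξ (σ u) a = true).card
      ≤ (13 / 16) ^ ℓ := by
  have hq : (0 : ℝ) < qI := by exact_mod_cast Nat.pos_of_ne_zero (NeZero.ne qI)
  rw [Finset.expect_comm]
  rw [← Fintype.expect_const (ι := Fin N → Fin qU) ((13 / 16 : ℝ) ^ ℓ)]
  refine expect_mono fun σ => ?_
  rw [Finset.expect_comm]
  simp only [expect_liked]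
  refine (expect_pow_card_image_le (by norm_num) (by norm_num) _).trans ?_
  rw [card_firstPos hℓM, Fintype.card_fin]
  have h := prod_arith_le (y := 5 / 8) (c := (1 - 5 / 8) / qI) (by norm_num)
    (div_nonneg (by norm_num) hq.le) ℓ
  have e : ∀ k : ℕ, (5 / 8 : ℝ) + (1 - 5 / 8) / qI * k = 5 / 8 + (1 - 5 / 8) * (k / qI) := by
    intro k; ring
  simp only [e] at h
  refine h.trans (pow_le_pow_left₀ (by positivity) ?_ _)
  have h1 : (ℓ : ℝ) / qI ≤ 1 := by rw [div_le_one hq]; exact_mod_cast hℓ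
  have : (1 - 5 / 8) / (qI : ℝ) * ℓ / 2 = 3 / 16 * (ℓ / qI) := by ring
  rw [this]; linarith

open Classical in
/-- If few items of the first block have a covered type, then one of four rare things happened. -/
theorem shortage_le {N qU qI M : ℕ} (ξ : Fin qU → Fin qI → Bool) (σ : Fin N → Fin qU)
    (U₁ U₂ : Fin M → Finset (Fin N)) (x y : Fin M → Fin qI) {ℓ T : ℕ} (hℓ : 0 < ℓ)
    (u : Fin N) :
    (T : ℝ) * (if (Finset.univ.filter fun i =>
        ¬ Confusable ξ σ (U₁ i) (x i) ∧ x i ∈ coveredTypes ξ σ U₂ y ℓ u).card < T then 1 else 0)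
      ≤ (∑ i, if Confusable ξ σ (U₁ i) (x i) then (1 : ℝ) else 0)
        + 32 * T / ℓ * (∑ k ∈ firstPos M ℓ, if Confusable ξ σ (U₂ k) (y k) then (1 : ℝ) else 0)
        + T * (4 : ℝ) ^ (3 * ℓ / 32 : ℝ)
          * (1 / 4) ^ (((firstPos M ℓ).image y).filter fun a => ξ (σ u) a = true).card
        + T * 4 ^ T * (if (ℓ : ℝ) ≤ 16 * (coveredTypes ξ σ U₂ y ℓ u).card then
            (1 / 2) ^ (Finset.univ.filter fun i => x i ∈ coveredTypes ξ σ U₂ y ℓ u).card else 0) := by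
  have hl : (0 : ℝ) < ℓ := by exact_mod_cast hℓ
  set A := coveredTypes ξ σ U₂ y ℓ u with hA
  set D := ((firstPos M ℓ).image y).filter fun a => ξ (σ u) a = true with hD
  have t1 : 0 ≤ ∑ i, if Confusable ξ σ (U₁ i) (x i) then (1 : ℝ) else 0 :=
    Finset.sum_nonneg fun i _ => by split_ifs <;> norm_num
  have t2 : 0 ≤ 32 * (T : ℝ) / ℓ
      * (∑ k ∈ firstPos M ℓ, if Confusable ξ σ (U₂ k) (y k) then (1 : ℝ) else 0) :=
    mul_nonneg (by positivity) (Finset.sum_nonneg fun i _ => by split_ifs <;> norm_num)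
  have t3 : 0 ≤ (T : ℝ) * (4 : ℝ) ^ (3 * ℓ / 32 : ℝ) * (1 / 4) ^ D.card := by positivity
  have t4 : 0 ≤ (T : ℝ) * 4 ^ T * (if (ℓ : ℝ) ≤ 16 * A.card then
            (1 / 2) ^ (Finset.univ.filter fun i => x i ∈ A).card else 0) :=
    mul_nonneg (by positivity) (by split_ifs <;> positivity)
  by_cases hshort : (Finset.univ.filter fun i =>
        ¬ Confusable ξ σ (U₁ i) (x i) ∧ x i ∈ A).card < T
  swap
  · rw [if_neg hshort]; linarith
  rw [if_pos hshort, mul_one]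
  by_cases h1 : T ≤ (Finset.univ.filter fun i => Confusable ξ σ (U₁ i) (x i)).card
  · have : (T : ℝ) ≤ ∑ i, if Confusable ξ σ (U₁ i) (x i) then (1 : ℝ) else 0 := by
      rw [Finset.sum_boole]; exact_mod_cast h1
    linarith
  -- Fewer than `T` of these items are confusable and fewer than `T` are not.
  have h2T : (Finset.univ.filter fun i => x i ∈ A).card ≤ 2 * T := by
    have hsub : (Finset.univ.filter fun i => x i ∈ A)
        ⊆ (Finset.univ.filter fun i => Confusable ξ σ (U₁ i) (x i))
          ∪ (Finset.univ.filter fun i => ¬ Confusable ξ σ (U₁ i) (x i) ∧ x i ∈ A) := by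
      intro i; simp only [Finset.mem_filter, Finset.mem_union, Finset.mem_univ, true_and]; tauto
    have := (Finset.card_le_card hsub).trans (Finset.card_union_le _ _)
    omega
  by_cases h4 : (ℓ : ℝ) ≤ 16 * A.card
  · rw [if_pos h4]
    have : (T : ℝ) ≤ T * 4 ^ T * (1 / 2) ^ (Finset.univ.filter fun i => x i ∈ A).card := by
      rw [mul_assoc]
      refine le_mul_of_one_le_right (by positivity) ?_
      calc (1 : ℝ) = 4 ^ T * (1 / 2) ^ (2 * T) := by
            rw [pow_mul, ← mul_pow]; norm_num
        _ ≤ _ := mul_le_mul_of_nonneg_left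
            (pow_le_pow_of_le_one (by norm_num) (by norm_num) h2T) (by positivity)
    rw [if_pos h4] at t4
    linarith
  by_cases h2 : (ℓ : ℝ) ≤ 32 * ((firstPos M ℓ).filter fun k => Confusable ξ σ (U₂ k) (y k)).card
  · have : (T : ℝ) ≤ 32 * T / ℓ
        * (∑ k ∈ firstPos M ℓ, if Confusable ξ σ (U₂ k) (y k) then (1 : ℝ) else 0) := by
      rw [Finset.sum_boole, div_mul_eq_mul_div, le_div_iff₀ hl]
      nlinarith [(Nat.cast_nonneg T : (0 : ℝ) ≤ T)]
    linarith
  have hDA : D.card ≤ A.card + ((firstPos M ℓ).filter fun k => Confusable ξ σ (U₂ k) (y k)).card := by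
    have hsub : D ⊆ A ∪ ((firstPos M ℓ).filter fun k => Confusable ξ σ (U₂ k) (y k)).image y := by
      intro a ha
      rw [hD, Finset.mem_filter, Finset.mem_image] at ha
      obtain ⟨⟨k, hk, rfl⟩, hlike⟩ := ha
      by_cases hc : Confusable ξ σ (U₂ k) (y k)
      · exact Finset.mem_union_right _ (Finset.mem_image_of_mem _ (Finset.mem_filter.2 ⟨hk, hc⟩))
      · refine Finset.mem_union_left _ ?_
        rw [hA, coveredTypes]
        exact Finset.mem_image_of_mem _ (Finset.mem_filter.2 ⟨hk, hc, hlike⟩)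
    exact (Finset.card_le_card hsub).trans ((Finset.card_union_le _ _).trans
      (Nat.add_le_add_left Finset.card_image_le _))
  -- In the last case `|A| < ℓ/16` and fewer than `ℓ/32` positions are confusable, which leaves
  -- `2ℓ/32 + ℓ/32`.
  have hDl : (D.card : ℝ) ≤ 3 * ℓ / 32 := by
    have : (D.card : ℝ) ≤ A.card
      + ((firstPos M ℓ).filter fun k => Confusable ξ σ (U₂ k) (y k)).card := by exact_mod_cast hDA
    linarith
  have : (T : ℝ) ≤ (T : ℝ) * (4 : ℝ) ^ (3 * ℓ / 32 : ℝ) * (1 / 4) ^ D.card := by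
    rw [mul_assoc]
    refine le_mul_of_one_le_right (by positivity) ?_
    rw [one_div, inv_pow, ← div_eq_mul_inv, le_div_iff₀ (by positivity), one_mul,
      ← Real.rpow_natCast]
    exact Real.rpow_le_rpow_of_exponent_le (by norm_num) hDl
  linarith

open Classical in
/-- The two terms of the loss in the exploitation phase, for given latent variables. -/
noncomputable def exploitLoss {N qU qI M : ℕ} (U₁ U₂ : Fin M → Finset (Fin N)) (ℓ T : ℕ)
    (ξ : Fin qU → Fin qI → Bool) (σ : Fin N → Fin qU) (x y : Fin M → Fin qI) : ℝ :=
  (∑ i, if Confusable ξ σ (U₁ i) (x i) then (1 : ℝ) else 0)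
    + 1 / N * ∑ u, (T : ℝ) * (if (Finset.univ.filter fun i =>
        ¬ Confusable ξ σ (U₁ i) (x i) ∧ x i ∈ coveredTypes ξ σ U₂ y ℓ u).card < T then 1 else 0)

section

variable {N qU qI M : ℕ} [NeZero qI]

/-- The type of item `i` is independent of preferences and user types, so a bound uniform over fixed
types survives averaging. -/
theorem expect_first_le {q : ℝ} (F : (Fin qU → Fin qI → Bool) → (Fin N → Fin qU) → Fin qI → ℝ)
    (h : ∀ a, 𝔼 ξ, 𝔼 σ, F ξ σ a ≤ q) (i : Fin M) :
    𝔼 ξ, 𝔼 σ, 𝔼 x : Fin M → Fin qI, F ξ σ (x i) ≤ q := by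
  have h1 : ∀ ξ, 𝔼 σ, 𝔼 x : Fin M → Fin qI, F ξ σ (x i)
      = 𝔼 x : Fin M → Fin qI, 𝔼 σ, F ξ σ (x i) := fun ξ => Finset.expect_comm _ _ _
  simp only [h1]
  rw [Finset.expect_comm, ← Fintype.expect_const (ι := Fin M → Fin qI) q]
  exact expect_mono fun x => h (x i)

-- The average of `shortage_le`, term by term. Confusable items of the first set count twice, as bad
-- exploitation and as a cause of shortage, hence `2 * M`.
open Classical in
theorem expect_exploitLoss_le [NeZero N] [NeZero qU] {r ℓ T : ℕ} (U₁ U₂ : Fin M → Finset (Fin N))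
    (hU₁ : ∀ i, (U₁ i).card = r) (hU₂ : ∀ i, (U₂ i).card = r) (hr : 4 * r ≤ qU)
    (hℓ : 0 < ℓ) (hℓI : ℓ ≤ qI) (hℓM : ℓ ≤ M) (hM : 64 * qI * T ≤ M * ℓ) :
    𝔼 ξ : Fin qU → Fin qI → Bool, 𝔼 σ, 𝔼 x, 𝔼 y, exploitLoss U₁ U₂ ℓ T ξ σ x y
      ≤ (2 * M + 32 * T) * (qI * (5 / 8) ^ r)
        + T * (4 : ℝ) ^ (3 * ℓ / 32 : ℝ) * (13 / 16) ^ ℓ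
        + T * 4 ^ T * Real.exp (-(2 * T)) := by
  have hl : (0 : ℝ) < ℓ := by exact_mod_cast hℓ
  have hN : (N : ℝ) ≠ 0 := by exact_mod_cast NeZero.ne N
  have hqI : (0 : ℝ) < qI := by exact_mod_cast Nat.pos_of_ne_zero (NeZero.ne qI)
  have hpt : ∀ (ξ : Fin qU → Fin qI → Bool) σ x y, exploitLoss U₁ U₂ ℓ T ξ σ x y
      ≤ (∑ i, if Confusable ξ σ (U₁ i) (x i) then (1 : ℝ) else 0)
      + 1 / N * ∑ u : Fin N, ((∑ i, if Confusable ξ σ (U₁ i) (x i) then (1 : ℝ) else 0)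
        + 32 * T / ℓ * (∑ k ∈ firstPos M ℓ, if Confusable ξ σ (U₂ k) (y k) then (1 : ℝ) else 0)
        + T * (4 : ℝ) ^ (3 * ℓ / 32 : ℝ)
          * (1 / 4) ^ (((firstPos M ℓ).image y).filter fun a => ξ (σ u) a = true).card
        + T * 4 ^ T * (if (ℓ : ℝ) ≤ 16 * (coveredTypes ξ σ U₂ y ℓ u).card then
            (1 / 2) ^ (Finset.univ.filter fun i => x i ∈ coveredTypes ξ σ U₂ y ℓ u).card else 0)) := by
    intro ξ σ x y
    unfold exploitLoss
    gcongr with u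
    exact shortage_le ξ σ U₁ U₂ x y hℓ u
  refine (expect_mono fun ξ => expect_mono fun σ => expect_mono fun x => expect_mono fun y =>
    hpt ξ σ x y).trans ?_
  simp only [Finset.expect_add_distrib, ← Finset.mul_expect, Finset.expect_sum_comm,
    Finset.sum_add_distrib, Fintype.expect_const, mul_add]
  simp only [← Finset.mul_sum, Finset.sum_const, Finset.card_univ, Fintype.card_fin, nsmul_eq_mul]
  have b1 : ∑ i, 𝔼 ξ : Fin qU → Fin qI → Bool, 𝔼 σ : Fin N → Fin qU, 𝔼 x : Fin M → Fin qI,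
      (if Confusable ξ σ (U₁ i) (x i) then (1 : ℝ) else 0) ≤ M * (qI * (5 / 8) ^ r) := by
    have := Finset.sum_le_sum fun i (_ : i ∈ Finset.univ) => expect_first_le (M := M)
      (fun (ξ : Fin qU → Fin qI → Bool) (σ : Fin N → Fin qU) a =>
        if Confusable ξ σ (U₁ i) a then (1 : ℝ) else 0)
      (fun a => expect_confusable_le (U₁ i) (by rw [hU₁]; exact hr) a) i
    refine this.trans ?_
    simp [hU₁]
  have b2 : ∑ i ∈ firstPos M ℓ, 𝔼 ξ : Fin qU → Fin qI → Bool, 𝔼 σ : Fin N → Fin qU,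
      𝔼 x : Fin M → Fin qI,
      (if Confusable ξ σ (U₂ i) (x i) then (1 : ℝ) else 0) ≤ ℓ * (qI * (5 / 8) ^ r) := by
    have := Finset.sum_le_sum fun i (_ : i ∈ firstPos M ℓ) => expect_first_le (M := M)
      (fun (ξ : Fin qU → Fin qI → Bool) (σ : Fin N → Fin qU) a =>
        if Confusable ξ σ (U₂ i) a then (1 : ℝ) else 0)
      (fun a => expect_confusable_le (U₂ i) (by rw [hU₂]; exact hr) a) i
    refine this.trans ?_
    simp [hU₂, card_firstPos hℓM]
  have b3 : ∑ u : Fin N, 𝔼 ξ : Fin qU → Fin qI → Bool, 𝔼 σ : Fin N → Fin qU,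
      𝔼 y : Fin M → Fin qI,
      (1 / 4 : ℝ) ^ (((firstPos M ℓ).image y).filter fun a => ξ (σ u) a = true).card
      ≤ N * (13 / 16) ^ ℓ := by
    refine (Finset.sum_le_sum fun u _ => expect_distinct_liked_le hℓM hℓI u).trans ?_
    simp
  have b4 : ∑ u : Fin N, 𝔼 ξ : Fin qU → Fin qI → Bool, 𝔼 σ : Fin N → Fin qU,
      𝔼 x : Fin M → Fin qI, 𝔼 y : Fin M → Fin qI,
      (if (ℓ : ℝ) ≤ 16 * (coveredTypes ξ σ U₂ y ℓ u).card then
        (1 / 2 : ℝ) ^ (Finset.univ.filter fun i => x i ∈ coveredTypes ξ σ U₂ y ℓ u).card else 0)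
      ≤ N * Real.exp (-(2 * T)) := by
    have hu : ∀ u : Fin N, 𝔼 ξ : Fin qU → Fin qI → Bool, 𝔼 σ : Fin N → Fin qU,
      𝔼 x : Fin M → Fin qI, 𝔼 y : Fin M → Fin qI,
      (if (ℓ : ℝ) ≤ 16 * (coveredTypes ξ σ U₂ y ℓ u).card then
        (1 / 2 : ℝ) ^ (Finset.univ.filter fun i => x i ∈ coveredTypes ξ σ U₂ y ℓ u).card else 0)
      ≤ Real.exp (-(2 * T)) := by
      intro u
      rw [← Fintype.expect_const (ι := Fin qU → Fin qI → Bool) (Real.exp (-(2 * T)))]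
      refine expect_mono fun ξ => ?_
      rw [← Fintype.expect_const (ι := Fin N → Fin qU) (Real.exp (-(2 * T)))]
      refine expect_mono fun σ => ?_
      -- The covered types do not depend on `x`, so `x` is averaged with the set fixed; `|A| ≥ ℓ/16`
      -- and `M ℓ ≥ 64 qI T` give `M |A|/(2 qI) ≥ 2T`.
      rw [Finset.expect_comm, ← Fintype.expect_const (ι := Fin M → Fin qI) (Real.exp (-(2 * T)))]
      refine expect_mono fun y => ?_
      split_ifs with h
      · refine (expect_mem_pow _).trans (Real.exp_le_exp.2 (neg_le_neg ?_))
        rw [le_div_iff₀ (by positivity)]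
        have hM' : (64 * qI * T : ℝ) ≤ M * ℓ := by exact_mod_cast hM
        nlinarith [mul_le_mul_of_nonneg_left h (Nat.cast_nonneg M : (0 : ℝ) ≤ M)]
      · rw [Fintype.expect_const]; positivity
    refine (Finset.sum_le_sum fun u _ => hu u).trans ?_
    simp
  set Q := (qI : ℝ) * (5 / 8) ^ r
  have hN0 : (0 : ℝ) ≤ 1 / N := by positivity
  have hT0 : (0 : ℝ) ≤ T := by positivity
  have c2 : 32 * (T : ℝ) / ℓ * (ℓ * Q) = 32 * T * Q := by field_simp
  have b2' := mul_le_mul_of_nonneg_left b2 (by positivity : 0 ≤ 32 * (T : ℝ) / ℓ)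
  rw [c2] at b2'
  have b3' := mul_le_mul_of_nonneg_left (mul_le_mul_of_nonneg_left b3
    (by positivity : 0 ≤ (T : ℝ) * (4 : ℝ) ^ (3 * ℓ / 32 : ℝ))) hN0
  have b4' := mul_le_mul_of_nonneg_left (mul_le_mul_of_nonneg_left b4
    (by positivity : 0 ≤ (T : ℝ) * (4 : ℝ) ^ T)) hN0
  have e3 : 1 / (N : ℝ) * (T * (4 : ℝ) ^ (3 * ℓ / 32 : ℝ) * (N * (13 / 16) ^ ℓ))
      = T * (4 : ℝ) ^ (3 * ℓ / 32 : ℝ) * (13 / 16) ^ ℓ := by field_simp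
  have e4 : 1 / (N : ℝ) * (T * 4 ^ T * (N * Real.exp (-(2 * T))))
      = T * 4 ^ T * Real.exp (-(2 * T)) := by field_simp
  rw [e3] at b3'
  rw [e4] at b4'
  have e5 : ∀ z : ℝ, 1 / (N : ℝ) * (N * z) = z := fun z => by field_simp
  rw [e5, mul_left_comm (32 * (T : ℝ) / ℓ), e5]
  linarith

end

/-! ### Analysis of the algorithm for given ratings -/

theorem length_history {N : ℕ} (L : Fin N → ℕ → Bool) (A : Policy N) (t : ℕ) :
    (history L A t).length = t := by
  induction t with
  | zero => rfl
  | succ t ih => simp [history, ih]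

theorem mem_history {N : ℕ} {L : Fin N → ℕ → Bool} {A : Policy N} {t : ℕ}
    {e : Fin N → ℕ × Bool} :
    e ∈ history L A t ↔
      ∃ s < t, e = fun u => (A (history L A s) u, L u (A (history L A s) u)) := by
  induction t with
  | zero => simp [history]
  | succ t ih =>
    rw [history, List.mem_cons, ih]
    constructor
    · rintro (rfl | ⟨s, hs, rfl⟩)
      · exact ⟨t, by omega, rfl⟩
      · exact ⟨s, by omega, rfl⟩
    · rintro ⟨s, hs, rfl⟩
      rcases Nat.lt_succ_iff_lt_or_eq.1 hs with h | rfl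
      · exact Or.inr ⟨s, h, rfl⟩
      · exact Or.inl rfl

theorem rated_history {N : ℕ} {L : Fin N → ℕ → Bool} {A : Policy N} {t : ℕ} {u : Fin N} {i : ℕ} :
    Rated (history L A t) u i ↔ ∃ s < t, A (history L A s) u = i := by
  constructor
  · rintro ⟨e, he, h⟩
    obtain ⟨s, hs, rfl⟩ := mem_history.1 he
    exact ⟨s, hs, h⟩
  · rintro ⟨s, hs, h⟩
    exact ⟨_, mem_history.2 ⟨s, hs, rfl⟩, h⟩

/-- All ratings in the history are the true ones. -/
def Truthful {N : ℕ} (L : Fin N → ℕ → Bool) (h : History N) : Prop :=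
  ∀ e ∈ h, ∀ u, (e u).2 = L u (e u).1

theorem truthful_history {N : ℕ} (L : Fin N → ℕ → Bool) (A : Policy N) (t : ℕ) :
    Truthful L (history L A t) := by
  intro e he u
  obtain ⟨s, -, rfl⟩ := mem_history.1 he
  rfl

section Loop

variable {N M : ℕ} {α : Type*} {L : Fin N → ℕ → Bool} {τ : ℕ → α} {V : ℕ → Finset (Fin N)}
  {ℓ : ℕ} {π : Equiv.Perm (Fin M)} {m : Memory N} {h : History N}

theorem Truthful.agree (hh : Truthful L h) {i j : ℕ} (hij : ∀ u, L u i = L u j) :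
    Agree h i j := by
  intro u e he e' he' h1 h2
  rw [hh e he, hh e' he', h1, h2, hij]

theorem Truthful.eq_of_agree (hh : Truthful L h) {i j : ℕ} (ha : Agree h i j) {u : Fin N}
    (hi : Rated h u i) (hj : Rated h u j) : L u i = L u j := by
  obtain ⟨e, he, h1⟩ := hi
  obtain ⟨e', he', h2⟩ := hj
  have := ha u e he e' he' h1 h2
  rwa [hh e he, hh e' he', h1, h2] at this

theorem Truthful.liked_iff (hh : Truthful L h) {u : Fin N} {i : ℕ} (hi : Rated h u i) :
    Liked h u i ↔ L u i = true := by
  constructor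
  · rintro ⟨e, he, h1⟩
    have := hh e he u
    rw [h1] at this
    exact this.symm
  · intro hL
    obtain ⟨e, he, h1⟩ := hi
    refine ⟨e, he, Prod.ext h1 ?_⟩
    rw [hh e he, h1, hL]

theorem nextRep_eq_some {ρ : ℕ} (hρ : nextRep ℓ π m = some ρ) :
    m.reps < ℓ ∧ ρ ∈ m.M₂ ∧
      ∃ k : Fin M, M + (π k : ℕ) = ρ ∧ ∀ k' < k, M + (π k' : ℕ) ∉ m.M₂ := by
  unfold nextRep at hρ
  split_ifs at hρ with hr
  rw [List.find?_eq_some_iff_getElem] at hρ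
  obtain ⟨h1, i, hi, h2, h3⟩ := hρ
  have hiM : i < M := by simpa using hi
  refine ⟨hr, by simpa using h1, ⟨i, hiM⟩, by simpa using h2, ?_⟩
  intro k' hk'
  have := h3 k' hk'
  simpa using this

theorem nextRep_eq_none (hρ : nextRep ℓ π m = none) :
    ℓ ≤ m.reps ∨ ∀ k : Fin M, M + (π k : ℕ) ∉ m.M₂ := by
  unfold nextRep at hρ
  split_ifs at hρ with hr
  · right
    rw [List.find?_eq_none] at hρ
    intro k
    have := hρ (M + (π k : ℕ)) (by simp [List.mem_ofFn])
    simpa using this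
  · exact Or.inl (not_lt.1 hr)

/-- What is known during the loop when `Q` is the set of representatives used so far; `τ` gives
the types of the items and `V` the users that have rated them in the preliminary exploration. -/
structure LoopInv (L : Fin N → ℕ → Bool) (τ : ℕ → α) (V : ℕ → Finset (Fin N))
    (π : Equiv.Perm (Fin M)) (Q : Set ℕ) (m : Memory N) : Prop where
  removed_fst : ∀ i < M, i ∉ m.M₁ →
    ∃ ρ ∈ Q, (∀ v ∈ V i, L v i = L v ρ) ∧ ∀ u, L u ρ = true → i ∈ m.R u
  left_fst : ∀ i ∈ m.M₁, i < M ∧ ∀ ρ ∈ Q, τ i ≠ τ ρ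
  removed_snd : ∀ k : Fin M, M + (π k : ℕ) ∉ m.M₂ →
    ∃ ρ ∈ Q, ∀ v ∈ V (M + π k), L v (M + π k) = L v ρ
  passed : ∀ k : Fin M, (k : ℕ) < m.reps → M + (π k : ℕ) ∉ m.M₂
  exploitable : ∀ u, ∀ i ∈ m.R u, i < M ∧ ∃ ρ, L u ρ = true ∧ ∀ v ∈ V i, L v i = L v ρ

theorem LoopInv.init :
    LoopInv L τ V π ∅ ⟨Finset.range M, Finset.Ico M (2 * M), 0, fun _ => ∅⟩ where
  removed_fst i hi hn := absurd (Finset.mem_range.2 hi) hn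
  left_fst i hi := ⟨Finset.mem_range.1 hi, by simp⟩
  removed_snd k hk := absurd (Finset.mem_Ico.2 ⟨by omega, by omega⟩) hk
  passed k hk := absurd hk (by simp)
  exploitable u i hi := absurd hi (by simp)

/-- Agreement in the history implies agreement on `V i` and is implied by equality of types. The
removal and exploitation clauses use the first fact, the clause on what is left in the first set
uses the second. -/
theorem LoopInv.absorb {Q : Set ℕ} (inv : LoopInv L τ V π Q m)
    (hτ : ∀ i j, τ i = τ j → ∀ u, L u i = L u j) {ρ : ℕ} (hρ : nextRep ℓ π m = some ρ)
    (hh : Truthful L h) (hV : ∀ i, ∀ v ∈ V i, Rated h v i) (hR : ∀ u, Rated h u ρ) :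
    LoopInv L τ V π (insert ρ Q) (absorbRep h ρ m) := by
  classical
  obtain ⟨-, -, k₀, hk₀, hfirst⟩ := nextRep_eq_some hρ
  have hag : ∀ i, Agree h i ρ → ∀ v ∈ V i, L v i = L v ρ :=
    fun i ha v hv => hh.eq_of_agree ha (hV i v hv) (hR v)
  refine ⟨?_, ?_, ?_, ?_, ?_⟩
  · intro i hi hn
    by_cases hm : i ∈ m.M₁
    · have ha : Agree h i ρ := by
        by_contra ha
        exact hn (by simp [absorbRep, hm, ha])
      refine ⟨ρ, Set.mem_insert _ _, hag i ha, fun u hu => ?_⟩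
      simp [absorbRep, (hh.liked_iff (hR u)).2 hu, hm, ha]
    · obtain ⟨ρ', hρ', h1, h2⟩ := inv.removed_fst i hi hm
      refine ⟨ρ', Set.mem_insert_of_mem _ hρ', h1, fun u hu => ?_⟩
      have := h2 u hu
      simp only [absorbRep]
      split_ifs
      · exact Finset.mem_union_left _ this
      · exact this
  · intro i hi
    simp only [absorbRep, Finset.mem_filter] at hi
    refine ⟨(inv.left_fst i hi.1).1, ?_⟩
    rintro ρ' (rfl | hρ')
    · exact fun he => hi.2 (hh.agree (hτ _ _ he))
    · exact (inv.left_fst i hi.1).2 ρ' hρ'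
  · intro k hk
    by_cases hm : M + (π k : ℕ) ∈ m.M₂
    · have ha : Agree h (M + π k) ρ := by
        by_contra ha
        exact hk (by simp [absorbRep, hm, ha])
      exact ⟨ρ, Set.mem_insert _ _, hag _ ha⟩
    · obtain ⟨ρ', hρ', h1⟩ := inv.removed_snd k hm
      exact ⟨ρ', Set.mem_insert_of_mem _ hρ', h1⟩
  · intro k hk hmem
    simp only [absorbRep, Finset.mem_filter] at hk hmem
    -- The first `reps` positions are already gone, so the new representative sits at `reps` or
    -- later. All positions before it are empty, and it removes itself because it agrees with
    -- itself.
    have hk₀r : m.reps ≤ (k₀ : ℕ) := by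
      by_contra hlt
      exact inv.passed k₀ (by omega) (hk₀ ▸ (nextRep_eq_some hρ).2.1)
    rcases Nat.lt_or_ge k k₀ with hlt | hge
    · exact hfirst k hlt hmem.1
    · have : k = k₀ := Fin.ext (by omega)
      subst this
      exact hmem.2 (hh.agree (by rw [hk₀]; exact fun _ => rfl))
  · intro u i hi
    simp only [absorbRep] at hi
    split_ifs at hi with hl
    · rcases Finset.mem_union.1 hi with hi | hi
      · exact inv.exploitable u i hi
      · rw [Finset.mem_filter] at hi
        exact ⟨(inv.left_fst i hi.1).1, ρ, (hh.liked_iff (hR u)).1 hl, hag i hi.2⟩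
    · exact inv.exploitable u i hi

/-- The users `V i` distinguish item `i` from all items of other types. -/
def Clear (L : Fin N → ℕ → Bool) (τ : ℕ → α) (V : ℕ → Finset (Fin N)) (i : ℕ) : Prop :=
  ∀ j, (∀ v ∈ V i, L v i = L v j) → τ j = τ i

/-- After the loop, each clear item of the first set is exploited for the users that like it, if
its type is also that of a clear item among the first `ℓ` ones of the second set. -/
theorem LoopInv.mem_R {Q : Set ℕ} (inv : LoopInv L τ V π Q m)
    (hτ : ∀ i j, τ i = τ j → ∀ u, L u i = L u j) (hρ : nextRep ℓ π m = none)
    {i : ℕ} (hi : i < M) (hci : Clear L τ V i) {k : Fin M} (hk : (k : ℕ) < ℓ)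
    (hck : Clear L τ V (M + π k)) (hki : τ (M + π k) = τ i) {u : Fin N} (hu : L u i = true) :
    i ∈ m.R u := by
  have hk2 : M + (π k : ℕ) ∉ m.M₂ := by
    rcases nextRep_eq_none hρ with hr | hr
    · exact inv.passed k (by omega)
    · exact hr k
  obtain ⟨ρ, hρQ, h1⟩ := inv.removed_snd k hk2
  -- As position `k` is clear, `ρ` has the type of `i`, and no item of that type is left in the
  -- first set. Another `ρ'` may have removed `i`, but `i` is clear, so `ρ'` has the same type.
  have hi1 : i ∉ m.M₁ := fun hmem =>
    (inv.left_fst i hmem).2 ρ hρQ (by rw [hck ρ h1, hki])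
  obtain ⟨ρ', -, h2, h3⟩ := inv.removed_fst i hi hi1
  exact h3 u (by rw [hτ _ _ (hci ρ' h2), hu])

/-- An item enters `R u` by agreeing on `V i` with a representative that `u` likes; a clear item
would share its type and be liked too. -/
theorem LoopInv.not_clear {Q : Set ℕ} (inv : LoopInv L τ V π Q m)
    (hτ : ∀ i j, τ i = τ j → ∀ u, L u i = L u j) {u : Fin N} {i : ℕ} (hi : i ∈ m.R u)
    (hu : L u i = false) : i < M ∧ ¬ Clear L τ V i := by
  obtain ⟨hiM, ρ, h1, h2⟩ := inv.exploitable u i hi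
  refine ⟨hiM, fun hc => ?_⟩
  rw [← hτ _ _ (hc ρ h2), h1] at hu
  exact absurd hu (by simp)

end Loop

/-- The users to whom the plan recommends the item with label `i`. -/
def planUsers {N M P : ℕ} (S : Plan N M P) (i : ℕ) : Finset (Fin N) :=
  Finset.univ.filter fun u => ∃ s k, S s u = some k ∧ (k : ℕ) = i

theorem planUsers_eq {N M P : ℕ} (S : Plan N M P) (k : Fin (2 * M)) :
    planUsers S k = S.users k := by
  ext u
  simp only [planUsers, Plan.users, Finset.mem_filter, Finset.mem_univ, true_and]
  constructor
  · rintro ⟨s, k', h, hk⟩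
    exact ⟨s, by rw [h, Fin.ext hk]⟩
  · rintro ⟨s, h⟩
    exact ⟨s, k, h, rfl⟩

section Trajectory

variable {N M P ℓ : ℕ} (pick : History N → Fin N → Finset ℕ → ℕ) (S : Plan N M P)
  (π : Equiv.Perm (Fin M)) (L : Fin N → ℕ → Bool)

/-- The memory of the algorithm after `t` time steps. -/
noncomputable def memoryAt (ℓ : ℕ) (t : ℕ) : Memory N :=
  memory ℓ P π (history L (itemItemPolicy ℓ pick S π) t)

theorem memoryAt_zero :
    memoryAt pick S π L ℓ 0 = ⟨Finset.range M, Finset.Ico M (2 * M), 0, fun _ => ∅⟩ := rfl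

theorem memoryAt_succ_prelim {t : ℕ} (ht : t < P) :
    memoryAt pick S π L ℓ (t + 1) = memoryAt pick S π L ℓ t := by
  simp only [memoryAt, history, memory, length_history, if_pos ht]

theorem memoryAt_succ_none {t : ℕ} (ht : nextRep ℓ π (memoryAt pick S π L ℓ t) = none) :
    memoryAt pick S π L ℓ (t + 1) = memoryAt pick S π L ℓ t := by
  unfold memoryAt at ht
  simp only [memoryAt, history, memory, ht]
  split_ifs <;> rfl

theorem memoryAt_succ_some {t ρ : ℕ} (hP : P ≤ t)
    (ht : nextRep ℓ π (memoryAt pick S π L ℓ t) = some ρ) :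
    memoryAt pick S π L ℓ (t + 1) = absorbRep (history L (itemItemPolicy ℓ pick S π) (t + 1)) ρ
      (memoryAt pick S π L ℓ t) := by
  unfold memoryAt at ht
  simp only [memoryAt, history, memory, ht, length_history, if_neg (not_lt.2 hP)]

theorem rated_of_mem_planUsers {i t : ℕ} (hP : P ≤ t) {v : Fin N} (hv : v ∈ planUsers S i) :
    Rated (history L (itemItemPolicy ℓ pick S π) t) v i := by
  simp only [planUsers, Finset.mem_filter, Finset.mem_univ, true_and] at hv
  obtain ⟨s, k, hs, rfl⟩ := hv
  refine rated_history.2 ⟨s, by omega, ?_⟩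
  simp only [itemItemPolicy, length_history]
  rw [dif_pos s.2]
  simp [hs]

theorem rated_rep {t ρ : ℕ} (hP : P ≤ t)
    (ht : nextRep ℓ π (memoryAt pick S π L ℓ t) = some ρ) (v : Fin N) :
    Rated (history L (itemItemPolicy ℓ pick S π) (t + 1)) v ρ := by
  classical
  by_cases h : Rated (history L (itemItemPolicy ℓ pick S π) t) v ρ
  · obtain ⟨s, hs, h⟩ := rated_history.1 h
    exact rated_history.2 ⟨s, by omega, h⟩
  · refine rated_history.2 ⟨t, by omega, ?_⟩
    unfold memoryAt at ht
    rw [itemItemPolicy, dif_neg (by rw [length_history]; omega), ht]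
    simp only [if_neg h]

theorem exists_loopInv {α : Type*} {τ : ℕ → α} (hτ : ∀ i j, τ i = τ j → ∀ u, L u i = L u j)
    (t : ℕ) : ∃ Q, LoopInv L τ (planUsers S) π Q (memoryAt pick S π L ℓ t) := by
  induction t with
  | zero => exact ⟨∅, LoopInv.init⟩
  | succ t ih =>
    obtain ⟨Q, inv⟩ := ih
    by_cases hP : t < P
    · rw [memoryAt_succ_prelim pick S π L hP]; exact ⟨Q, inv⟩
    · push Not at hP
      cases hρ : nextRep ℓ π (memoryAt pick S π L ℓ t) with
      | none => rw [memoryAt_succ_none pick S π L hρ]; exact ⟨Q, inv⟩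
      | some ρ =>
        rw [memoryAt_succ_some pick S π L hP hρ]
        exact ⟨insert ρ Q, inv.absorb hτ hρ (truthful_history _ _ _)
          (fun i v hv => rated_of_mem_planUsers pick S π L (by omega) hv)
          (rated_rep pick S π L hP hρ)⟩

/-- At most `ℓ` time steps are spent on representatives. -/
theorem card_rep_steps_le (t : ℕ) :
    ((Finset.range t).filter fun s =>
      P ≤ s ∧ nextRep ℓ π (memoryAt pick S π L ℓ s) ≠ none).card ≤ ℓ := by
  -- Each such step raises the counter `reps` by one, and `nextRep` requires `reps < ℓ`.
  have key : ((Finset.range t).filter fun s =>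
      P ≤ s ∧ nextRep ℓ π (memoryAt pick S π L ℓ s) ≠ none).card
        ≤ (memoryAt pick S π L ℓ t).reps ∧ (memoryAt pick S π L ℓ t).reps ≤ ℓ := by
    induction t with
    | zero => simp [memoryAt_zero]
    | succ t ih =>
      rw [Finset.range_add_one, Finset.filter_insert]
      by_cases hP : t < P
      · rw [if_neg (by omega), memoryAt_succ_prelim pick S π L hP]; exact ih
      · push Not at hP
        cases hρ : nextRep ℓ π (memoryAt pick S π L ℓ t) with
        | none =>
          rw [if_neg (by simp), memoryAt_succ_none pick S π L hρ]; exact ih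
        | some ρ =>
          rw [if_pos ⟨hP, by simp⟩, memoryAt_succ_some pick S π L hP hρ,
            Finset.card_insert_of_notMem (by simp)]
          have := (nextRep_eq_some hρ).1
          simp only [absorbRep]
          omega
  exact key.1.trans key.2

theorem itemItemPolicy_exploit (hpick : ∀ h u s, s.Nonempty → pick h u s ∈ s) {t : ℕ}
    (hP : P ≤ t) (ht : nextRep ℓ π (memoryAt pick S π L ℓ t) = none) (u : Fin N) :
    (∀ i ∈ (memoryAt pick S π L ℓ t).R u,
      Rated (history L (itemItemPolicy ℓ pick S π) t) u i) ∨
    (itemItemPolicy ℓ pick S π (history L (itemItemPolicy ℓ pick S π) t) u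
      ∈ (memoryAt pick S π L ℓ t).R u ∧
     ¬ Rated (history L (itemItemPolicy ℓ pick S π) t) u
      (itemItemPolicy ℓ pick S π (history L (itemItemPolicy ℓ pick S π) t) u)) := by
  classical
  set h := history L (itemItemPolicy ℓ pick S π) t with hh
  have ht' : nextRep ℓ π (memory ℓ P π h) = none := ht
  have hm : memoryAt pick S π L ℓ t = memory ℓ P π h := rfl
  by_cases hne : (((memory ℓ P π h).R u).filter fun i => ¬ Rated h u i).Nonempty
  · right
    have hval : itemItemPolicy ℓ pick S π h u
        = pick h u (((memory ℓ P π h).R u).filter fun i => ¬ Rated h u i) := by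
      rw [itemItemPolicy, dif_neg (by rw [hh, length_history]; omega), ht']
      exact if_pos hne
    rw [hval, hm]
    have := hpick h u _ hne
    rwa [Finset.mem_filter] at this
  · left
    intro i hi
    by_contra hr
    exact hne ⟨i, Finset.mem_filter.2 ⟨hi, hr⟩⟩

open Classical in
/-- The number of recommendations disliked by one user. -/
theorem card_disliked_le (hpick : ∀ h u s, s.Nonempty → pick h u s ∈ s) {α : Type*} [DecidableEq α] {τ : ℕ → α}
    (hτ : ∀ i j, τ i = τ j → ∀ u, L u i = L u j) (T : ℕ) (u : Fin N) :
    ((Finset.range T).filter fun t =>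
      L u (itemItemPolicy ℓ pick S π (history L (itemItemPolicy ℓ pick S π) t) u) = false).card
    ≤ P + ℓ + ((Finset.range M).filter fun i => ¬ Clear L τ (planUsers S) i).card
      + T * (if ((Finset.range M).filter fun i => Clear L τ (planUsers S) i ∧ L u i = true ∧
          ∃ k : Fin M, (k : ℕ) < ℓ ∧ Clear L τ (planUsers S) (M + π k) ∧
            τ (M + π k) = τ i).card < T then 1 else 0) := by
  set A := itemItemPolicy ℓ pick S π with hA
  set a : ℕ → ℕ := fun t => A (history L A t) u with ha
  let E : ℕ → Prop := fun t => P ≤ t ∧ nextRep ℓ π (memoryAt pick S π L ℓ t) = none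
  -- After the plan, a disliked step shows a representative (`D₁`), exploits a disliked item (`D₂`),
  -- or finds `R u` exhausted (`D₃`).
  let D₁ := (Finset.range T).filter fun t => P ≤ t ∧
    nextRep ℓ π (memoryAt pick S π L ℓ t) ≠ none
  let D₂ := (Finset.range T).filter fun t => E t ∧ L u (a t) = false ∧
    a t ∈ (memoryAt pick S π L ℓ t).R u ∧ ¬ Rated (history L A t) u (a t)
  let D₃ := (Finset.range T).filter fun t => E t ∧
    ∀ i ∈ (memoryAt pick S π L ℓ t).R u, Rated (history L A t) u i
  have hsub : ((Finset.range T).filter fun t => L u (a t) = false)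
      ⊆ Finset.range P ∪ D₁ ∪ D₂ ∪ D₃ := by
    intro t ht
    rw [Finset.mem_filter] at ht
    simp only [Finset.mem_union]
    by_cases hP : t < P
    · exact Or.inl (Or.inl (Or.inl (Finset.mem_range.2 hP)))
    · push Not at hP
      by_cases hn : nextRep ℓ π (memoryAt pick S π L ℓ t) = none
      · rcases itemItemPolicy_exploit pick S π L hpick hP hn u with h | h
        · exact Or.inr (Finset.mem_filter.2 ⟨ht.1, ⟨hP, hn⟩, h⟩)
        · exact Or.inl (Or.inr (Finset.mem_filter.2 ⟨ht.1, ⟨hP, hn⟩, ht.2, h⟩))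
      · exact Or.inl (Or.inl (Or.inr (Finset.mem_filter.2 ⟨ht.1, hP, hn⟩)))
  have h1 : D₁.card ≤ ℓ := card_rep_steps_le pick S π L T
  have h2 : D₂.card ≤ ((Finset.range M).filter fun i => ¬ Clear L τ (planUsers S) i).card := by
    refine Finset.card_le_card_of_injOn a ?_ ?_
    · intro t ht
      obtain ⟨-, -, hd, hR, -⟩ := Finset.mem_filter.1 (Finset.mem_coe.1 ht)
      obtain ⟨Q, inv⟩ := exists_loopInv (ℓ := ℓ) pick S π L hτ t
      have := inv.not_clear hτ hR hd
      exact Finset.mem_coe.2 (Finset.mem_filter.2 ⟨Finset.mem_range.2 this.1, this.2⟩)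
    -- An exploited item was not rated before, so no item is charged twice.
    · intro s hs t ht hst
      obtain ⟨-, -, -, -, hs'⟩ := Finset.mem_filter.1 (Finset.mem_coe.1 hs)
      obtain ⟨-, -, -, -, ht'⟩ := Finset.mem_filter.1 (Finset.mem_coe.1 ht)
      rcases lt_trichotomy s t with hlt | heq | hlt
      · exact absurd (rated_history.2 ⟨s, hlt, hst⟩) ht'
      · exact heq
      · exact absurd (rated_history.2 ⟨t, hlt, hst.symm⟩) hs'
  have h3 : D₃.card ≤ T * (if ((Finset.range M).filter fun i => Clear L τ (planUsers S) i ∧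
      L u i = true ∧ ∃ k : Fin M, (k : ℕ) < ℓ ∧ Clear L τ (planUsers S) (M + π k) ∧
            τ (M + π k) = τ i).card < T then 1 else 0) := by
    -- At a single exhausted step `t < T` all the good items are among the at most `t` items already
    -- rated, so there are fewer than `T` of them.
    by_cases hne : D₃.Nonempty
    · obtain ⟨t, ht⟩ := hne
      obtain ⟨htT, ⟨-, hn⟩, hall⟩ := Finset.mem_filter.1 ht
      rw [if_pos, mul_one]
      · exact (Finset.card_filter_le _ _).trans (by simp)
      · obtain ⟨Q, inv⟩ := exists_loopInv (ℓ := ℓ) pick S π L hτ t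
        refine lt_of_le_of_lt ?_ (Finset.mem_range.1 htT)
        calc _ ≤ ((Finset.range t).image a).card := by
              refine Finset.card_le_card fun i hi => ?_
              obtain ⟨hiM, hc, hl, k, hk, hck, hki⟩ := Finset.mem_filter.1 hi
              obtain ⟨s, hs, hsa⟩ := rated_history.1 (hall i
                (inv.mem_R hτ hn (Finset.mem_range.1 hiM) hc hk hck hki hl))
              exact Finset.mem_image.2 ⟨s, Finset.mem_range.2 hs, hsa⟩
          _ ≤ t := Finset.card_image_le.trans (by simp)
    · rw [Finset.not_nonempty_iff_eq_empty.1 hne]; simp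
  have hcard := (Finset.card_le_card hsub).trans ((Finset.card_union_le _ _).trans
    (Nat.add_le_add_right ((Finset.card_union_le _ _).trans
      (Nat.add_le_add_right (Finset.card_union_le _ _) _)) _))
  rw [Finset.card_range] at hcard
  change ((Finset.range T).filter fun t => L u (a t) = false).card ≤ _
  omega

end Trajectory

/-! ### Expected loss for a given seed -/

theorem loss_eq {N : ℕ} (L : Fin N → ℕ → Bool) (A : Policy N) (T : ℕ) :
    loss L A T = 1 / N * ∑ u, (((Finset.range T).filter fun t =>
      L u (A (history L A t) u) = false).card : ℝ) := by
  simp only [loss]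
  rw [← Finset.mul_sum, Finset.sum_comm]
  simp only [Finset.sum_boole]

theorem loss_nonneg {N : ℕ} (L : Fin N → ℕ → Bool) (A : Policy N) (T : ℕ) : 0 ≤ loss L A T := by
  rw [loss_eq]; positivity

theorem loss_le {N : ℕ} (L : Fin N → ℕ → Bool) (A : Policy N) (T : ℕ) : loss L A T ≤ T := by
  rw [loss_eq]
  calc _ ≤ 1 / (N : ℝ) * ∑ _u : Fin N, (T : ℝ) := by
        gcongr
        exact (Finset.card_filter_le _ _).trans (by simp)
    _ = (N : ℝ) / N * T := by
        rw [Finset.sum_const, Finset.card_univ, Fintype.card_fin, nsmul_eq_mul]; ring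
    _ ≤ T := mul_le_of_le_one_left (by positivity) (div_self_le_one _)

/-- Only the majorant has to be integrable, so measurability of the loss, a function of the whole
trajectory, never has to be shown. -/
theorem integral_loss_le_of_le {N qU qI T : ℕ} [NeZero qU] [NeZero qI] {A : Policy N}
    {g : Env N qU qI → ℝ} (hg : Integrable g (envLaw N qU qI))
    (h : ∀ ω, loss (rating ω) A T ≤ g ω) :
    ∫ ω, loss (rating ω) A T ∂(envLaw N qU qI) ≤ ∫ ω, g ω ∂(envLaw N qU qI) :=
  integral_mono_of_nonneg (Filter.Eventually.of_forall fun _ => loss_nonneg _ _ _) hg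
    (Filter.Eventually.of_forall h)

theorem rating_eq_of_type_eq {N qU qI : ℕ} (ω : Env N qU qI) (i j : ℕ) (h : ω.2.2 i = ω.2.2 j)
    (u : Fin N) : rating ω u i = rating ω u j := by
  simp only [rating, h]

theorem clear_of_not_confusable {N qU qI : ℕ} (ω : Env N qU qI) (V : ℕ → Finset (Fin N)) {i : ℕ}
    (h : ¬ Confusable ω.1 ω.2.1 (V i) (ω.2.2 i)) : Clear (rating ω) ω.2.2 V i := by
  intro j hj
  by_contra hne
  exact h ⟨ω.2.2 j, hne, hj⟩

section

variable {N qU qI M P ℓ : ℕ} {pick : History N → Fin N → Finset ℕ → ℕ}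

open Classical in
theorem loss_itemItemPolicy_le (hpick : ∀ h u s, s.Nonempty → pick h u s ∈ s) (hN : 0 < N)
    (S : Plan N M P) (π : Equiv.Perm (Fin M)) (T : ℕ) (ω : Env N qU qI) :
    loss (rating ω) (itemItemPolicy ℓ pick S π) T ≤ (P + ℓ : ℕ) +
      exploitLoss (fun i : Fin M => planUsers S i) (fun k : Fin M => planUsers S (M + π k)) ℓ T
        ω.1 ω.2.1 (fun i : Fin M => ω.2.2 i) (fun k : Fin M => ω.2.2 (M + π k)) := by
  have hN' : (N : ℝ) ≠ 0 := by positivity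
  rw [loss_eq]
  set c : ℝ := ∑ i : Fin M, if Confusable ω.1 ω.2.1 (planUsers S i) (ω.2.2 i) then (1 : ℝ) else 0
    with hc
  set f : Fin N → ℝ := fun u => (T : ℝ) * (if (Finset.univ.filter fun i : Fin M =>
        ¬ Confusable ω.1 ω.2.1 (planUsers S i) (ω.2.2 i) ∧ ω.2.2 i ∈
          coveredTypes ω.1 ω.2.1 (fun k : Fin M => planUsers S (M + π k))
            (fun k : Fin M => ω.2.2 (M + π k)) ℓ u).card < T then 1 else 0) with hf
  have hE : ((P + ℓ : ℕ) : ℝ) + exploitLoss (fun i : Fin M => planUsers S i)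
        (fun k : Fin M => planUsers S (M + π k)) ℓ T
        ω.1 ω.2.1 (fun i : Fin M => ω.2.2 i) (fun k : Fin M => ω.2.2 (M + π k))
      = 1 / N * ∑ u, (((P + ℓ : ℕ) : ℝ) + c + f u) := by
    rw [Finset.sum_add_distrib, Finset.sum_const, Finset.card_univ, Fintype.card_fin, nsmul_eq_mul,
      mul_add, ← mul_assoc, one_div_mul_cancel hN', one_mul, add_assoc]
    rfl
  rw [hE]
  gcongr with u
  have h1 := card_disliked_le (ℓ := ℓ) pick S π (rating ω) hpick (τ := ω.2.2)
    (rating_eq_of_type_eq ω) T u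
  refine (Nat.cast_le (α := ℝ).2 h1).trans ?_
  rw [Nat.cast_add, Nat.cast_add (P + ℓ)]
  gcongr
  · rw [hc, Finset.sum_boole, Nat.cast_le]
    refine Finset.card_le_card_of_surjOn (fun i : Fin M => (i : ℕ)) ?_
    intro i hi
    obtain ⟨hiM, hcl⟩ := Finset.mem_filter.1 (Finset.mem_coe.1 hi)
    refine ⟨⟨i, Finset.mem_range.1 hiM⟩, ?_, rfl⟩
    simp only [Finset.coe_filter, Finset.mem_univ, true_and, Set.mem_ofPred_eq]
    by_contra hcf
    exact hcl (clear_of_not_confusable ω _ hcf)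
  · rw [hf, Nat.cast_mul]
    refine mul_le_mul_of_nonneg_left ?_ (Nat.cast_nonneg T)
    rw [Nat.cast_ite, Nat.cast_one, Nat.cast_zero]
    split_ifs with h2 h3
    · rfl
    · refine absurd (lt_of_le_of_lt ?_ h2) h3
      refine Finset.card_le_card_of_injOn (fun i : Fin M => (i : ℕ)) ?_
        (Fin.val_injective.injOn)
      intro i hi
      obtain ⟨-, hcf, hcov⟩ := Finset.mem_filter.1 (Finset.mem_coe.1 hi)
      rw [coveredTypes, Finset.mem_image] at hcov
      obtain ⟨k, hk, hki⟩ := hcov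
      obtain ⟨hkℓ, hkc, hkl⟩ := Finset.mem_filter.1 hk
      refine Finset.mem_coe.2 (Finset.mem_filter.2 ⟨Finset.mem_range.2 i.2,
        clear_of_not_confusable ω _ hcf, ?_, k, (Finset.mem_filter.1 hkℓ).2,
        clear_of_not_confusable ω _ hkc, hki⟩)
      rw [rating, ← hki]
      exact hkl
    · norm_num
    · rfl

/-- For a fixed seed the types along `M + π k` are still i.i.d. and independent of those of the
first set, and the majorant involves only these `2M` items. Of the plan, only the size `r` of its
user sets matters. -/
theorem integral_loss_itemItemPolicy_le [NeZero N] [NeZero qU] [NeZero qI]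
    (hpick : ∀ h u s, s.Nonempty → pick h u s ∈ s) {r T : ℕ} (S : Plan N M P)
    (hS : ∀ k, (S.users k).card = r) (π : Equiv.Perm (Fin M)) (hr : 4 * r ≤ qU)
    (hℓ : 0 < ℓ) (hℓI : ℓ ≤ qI) (hℓM : ℓ ≤ M) (hM : 64 * qI * T ≤ M * ℓ) :
    ∫ ω, loss (rating ω) (itemItemPolicy ℓ pick S π) T ∂(envLaw N qU qI)
      ≤ P + ℓ + ((2 * M + 32 * T) * (qI * (5 / 8) ^ r)
        + T * (4 : ℝ) ^ (3 * ℓ / 32 : ℝ) * (13 / 16) ^ ℓ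
        + T * 4 ^ T * Real.exp (-(2 * T))) := by
  have hU : ∀ i : ℕ, i < 2 * M → (planUsers S i).card = r := fun i hi => by
    rw [← hS ⟨i, hi⟩, ← planUsers_eq]
  have hinj : Function.Injective fun k : Fin M => M + (π k : ℕ) := by
    intro k k' h
    simp only [add_right_inj] at h
    exact π.injective (Fin.ext h)
  obtain ⟨hint, hval⟩ := integral_envLaw_sum (N := N) (qU := qU) (qI := qI)
    (f := fun i : Fin M => (i : ℕ)) Fin.val_injective hinj (fun i k => by omega)
    (exploitLoss (fun i : Fin M => planUsers S i) (fun k : Fin M => planUsers S (M + π k)) ℓ T)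
  refine (integral_loss_le_of_le ((integrable_const ((P + ℓ : ℕ) : ℝ)).add hint)
    (loss_itemItemPolicy_le hpick (Nat.pos_of_ne_zero (NeZero.ne N)) S π T)).trans ?_
  simp only [Pi.add_apply]
  rw [integral_add (integrable_const _) hint, hval, integral_const]
  simp only [probReal_univ, smul_eq_mul, one_mul]
  push_cast
  gcongr
  exact expect_exploitLoss_le _ _ (fun i => hU i (by omega)) (fun k => hU _ (by omega)) hr hℓ hℓI
    hℓM hM

end

/-- Whatever the types, each single rating is a fair sign; by linearity, its being shared among
users is harmless. -/
theorem integral_loss_trivialPolicy {N qU qI : ℕ} [NeZero N] [NeZero qU] [NeZero qI] (T : ℕ) :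
    ∫ ω, loss (rating ω) (trivialPolicy N) T ∂(envLaw N qU qI) = T / 2 := by
  have hN : (N : ℝ) ≠ 0 := by exact_mod_cast NeZero.ne N
  have key : ∀ (t : ℕ) (u : Fin N),
      Integrable (fun ω : Env N qU qI => if rating ω u t = false then (1 : ℝ) else 0)
        (envLaw N qU qI) ∧
      ∫ ω, (if rating ω u t = false then (1 : ℝ) else 0) ∂(envLaw N qU qI) = 1 / 2 := by
    intro t u
    have h := integral_envLaw (N := N) (qU := qU) (qI := qI) (f := fun _ : Unit => t)
      (fun _ _ _ => rfl) (fun ξ σ τ => if ξ (σ u) (τ ()) = false then (1 : ℝ) else 0)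
    refine ⟨h.1, h.2.trans ?_⟩
    rw [Finset.expect_comm, ← Fintype.expect_const (ι := Fin N → Fin qU) (1 / 2 : ℝ)]
    refine Finset.expect_congr rfl fun σ _ => ?_
    rw [Finset.expect_comm, ← Fintype.expect_const (ι := Unit → Fin qI) (1 / 2 : ℝ)]
    refine Finset.expect_congr rfl fun τ _ => ?_
    have h1 := expect_prod_coord {σ u} (fun _ (w : Fin qI → Bool) =>
      if w (τ ()) = false then (1 : ℝ) else 0)
    have h2 := expect_prod_coord {τ ()} (fun _ (b : Bool) => if b = false then (1 : ℝ) else 0)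
    simp only [Finset.prod_singleton] at h1 h2
    rw [h1, h2, Fintype.expect_eq_sum_div_card]
    simp
  simp only [loss, trivialPolicy, length_history]
  rw [integral_finsetSum]
  · have : ∀ t : ℕ, ∫ ω : Env N qU qI, 1 / (N : ℝ) * ∑ u : Fin N,
        (if rating ω u t = false then (1 : ℝ) else 0) ∂(envLaw N qU qI) = 1 / 2 := by
      intro t
      rw [integral_const_mul, integral_finsetSum _ fun u _ => (key t u).1]
      simp only [(key t _).2, Finset.sum_const, Finset.card_univ, Fintype.card_fin, nsmul_eq_mul]
      field_simp
    simp only [this, Finset.sum_const, Finset.card_range, nsmul_eq_mul]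
    ring
  · exact fun t _ => (integrable_finsetSum _ fun u _ => (key t u).1).const_mul _

/-! ### The parameters -/

theorem two_le_rParam {N qI : ℕ} (hN : 0 < N) (hq : 0 < qI) : 2 ≤ rParam N qI := by
  have h1 : (1 : ℝ) ≤ N := by exact_mod_cast hN
  have h2 : (1 : ℝ) ≤ (qI : ℝ) ^ 2 := one_le_pow₀ (by exact_mod_cast hq)
  have h : (1 : ℝ) ≤ Real.logb 2 (2 * (N : ℝ) * (qI : ℝ) ^ 2) := by
    rw [Real.le_logb_iff_rpow_le (by norm_num) (by positivity), Real.rpow_one]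
    nlinarith
  have : (2 : ℝ) ≤ rParam N qI := le_trans (by linarith) (Nat.le_ceil _)
  exact_mod_cast this

/-- This makes `T/N` at most an eighth of `(r/N) T`, so that the error terms fit under the last term
of `Ybound`. -/
theorem eight_le_rParam {N qI : ℕ} (hN : 8 ≤ N) (hq : 0 < qI) : 8 ≤ rParam N qI := by
  have h1 : (8 : ℝ) ≤ N := by exact_mod_cast hN
  have h2 : (1 : ℝ) ≤ (qI : ℝ) ^ 2 := one_le_pow₀ (by exact_mod_cast hq)
  have h : (4 : ℝ) ≤ Real.logb 2 (2 * (N : ℝ) * (qI : ℝ) ^ 2) := by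
    rw [Real.le_logb_iff_rpow_le (by norm_num) (by positivity)]
    norm_num
    nlinarith
  have : (8 : ℝ) ≤ rParam N qI := le_trans (by linarith) (Nat.le_ceil _)
  exact_mod_cast this

/-- Since `5/8 ≤ 2^(-1/2)`, the choice of `r` gives `(5/8)^r ≤ 1/(2 N qI^2)`. -/
theorem pow_rParam_le {N qI : ℕ} (hN : 0 < N) (hq : 0 < qI) :
    (qI : ℝ) * (5 / 8) ^ rParam N qI ≤ 1 / (2 * N * qI) := by
  have hN' : (0 : ℝ) < N := by exact_mod_cast hN
  have hq' : (0 : ℝ) < qI := by exact_mod_cast hq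
  have hX : (0 : ℝ) < 2 * (N : ℝ) * (qI : ℝ) ^ 2 := by positivity
  have hr : 2 * Real.logb 2 (2 * (N : ℝ) * (qI : ℝ) ^ 2) ≤ rParam N qI := Nat.le_ceil _
  have h58 : (5 / 8 : ℝ) ≤ 2 ^ (-(1 / 2) : ℝ) := by
    rw [Real.rpow_neg (by norm_num), ← Real.sqrt_eq_rpow]
    rw [le_inv_comm₀ (by norm_num) (by positivity), Real.sqrt_le_left (by norm_num)]
    norm_num
  have h : (5 / 8 : ℝ) ^ rParam N qI ≤ (2 * (N : ℝ) * (qI : ℝ) ^ 2)⁻¹ := by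
    calc (5 / 8 : ℝ) ^ rParam N qI ≤ (2 ^ (-(1 / 2) : ℝ)) ^ rParam N qI :=
          pow_le_pow_left₀ (by norm_num) h58 _
      _ = 2 ^ (-(1 / 2) * (rParam N qI : ℝ)) := by
          rw [← Real.rpow_natCast, ← Real.rpow_mul (by norm_num)]
      _ ≤ 2 ^ (-Real.logb 2 (2 * (N : ℝ) * (qI : ℝ) ^ 2)) :=
          Real.rpow_le_rpow_of_exponent_le (by norm_num) (by linarith)
      _ = _ := by
          rw [Real.rpow_neg (by norm_num), Real.rpow_logb (by norm_num) (by norm_num) hX]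
  calc (qI : ℝ) * (5 / 8) ^ rParam N qI ≤ qI * (2 * (N : ℝ) * (qI : ℝ) ^ 2)⁻¹ := by gcongr
    _ = _ := by field_simp

theorem rpow_mul_pow_le (ℓ : ℕ) :
    (4 : ℝ) ^ (3 * ℓ / 32 : ℝ) * (13 / 16) ^ ℓ ≤ 2 ^ (-(ℓ / 10) : ℝ) := by
  -- The exponent `23/80` lies just below `log₂(16/13)` and satisfies `3/16 - 23/80 = -1/10`.
  have h0 : (13 / 16 : ℝ) ≤ 2 ^ (-(23 / 80) : ℝ) := by
    rw [← pow_le_pow_iff_left₀ (n := 80) (by norm_num) (by positivity) (by norm_num),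
      ← Real.rpow_natCast (2 ^ (-(23 / 80) : ℝ)), ← Real.rpow_mul (by norm_num)]
    have : (-(23 / 80) * ((80 : ℕ) : ℝ)) = -((23 : ℕ) : ℝ) := by norm_num
    rw [this, Real.rpow_neg (by norm_num), Real.rpow_natCast]
    norm_num
  have h4 : (4 : ℝ) ^ (3 * ℓ / 32 : ℝ) = 2 ^ (3 * ℓ / 16 : ℝ) := by
    have : (4 : ℝ) = 2 ^ (2 : ℝ) := by norm_num
    rw [this, ← Real.rpow_mul (by norm_num)]
    congr 1; ring
  calc (4 : ℝ) ^ (3 * ℓ / 32 : ℝ) * (13 / 16) ^ ℓ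
      ≤ 2 ^ (3 * ℓ / 16 : ℝ) * (2 ^ (-(23 / 80) : ℝ)) ^ ℓ := by
        rw [h4]; gcongr
    _ = 2 ^ (-(ℓ / 10) : ℝ) := by
        rw [← Real.rpow_natCast, ← Real.rpow_mul (by norm_num), ← Real.rpow_add (by norm_num)]
        congr 1; ring

/-- From `4 ≤ e^(3/2)` and `T ≤ 2 e^(T/2)`. -/
theorem mul_four_pow_mul_exp_le (T : ℕ) : (T : ℝ) * 4 ^ T * Real.exp (-(2 * T)) ≤ 2 := by
  have h4 : (4 : ℝ) ≤ Real.exp (3 / 2) := by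
    rw [← Real.log_le_iff_le_exp (by norm_num)]
    have : (4 : ℝ) = 2 ^ 2 := by norm_num
    rw [this, Real.log_pow]
    have := Real.log_two_lt_d9
    push_cast; linarith
  have h : (4 : ℝ) ^ T ≤ Real.exp (3 / 2 * T) := by
    rw [mul_comm, Real.exp_nat_mul]; gcongr
  have h2 := Real.add_one_le_exp ((T : ℝ) / 2)
  calc (T : ℝ) * 4 ^ T * Real.exp (-(2 * T))
      ≤ 2 * Real.exp (T / 2) * Real.exp (3 / 2 * T) * Real.exp (-(2 * T)) := by
        gcongr; linarith
    _ = 2 := by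
        rw [mul_assoc, mul_assoc, ← Real.exp_add, ← Real.exp_add]
        have : (T : ℝ) / 2 + (3 / 2 * T + -(2 * T)) = 0 := by ring
        rw [this, Real.exp_zero, mul_one]

section

variable {N qI T : ℕ}

theorem ellParam_le_qI : ellParam T qI N ≤ qI := min_le_right _ _

theorem ellParam_pos (hN : 0 < N) (hq : 0 < qI) (hT : 1 ≤ T) : 0 < ellParam T qI N := by
  have hr := two_le_rParam hN hq
  have hN' : (0 : ℝ) < N := by exact_mod_cast hN
  have hq' : (0 : ℝ) < qI := by exact_mod_cast hq
  have hr' : (0 : ℝ) < rParam N qI := by exact_mod_cast (by omega : 0 < rParam N qI)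
  have hT' : (1 : ℝ) ≤ T := by exact_mod_cast hT
  refine lt_min (Nat.ceil_pos.2 ?_) hq
  have := Real.logb_nonneg (b := 2) (by norm_num) hT'
  positivity

theorem sqrt_ell_bounds (z : ℝ) :
    18.16 * Real.sqrt z ≤ Real.sqrt (330 * z) ∧ Real.sqrt (330 * z) ≤ 18.17 * Real.sqrt z := by
  rw [Real.sqrt_mul (by norm_num)]
  constructor
  · gcongr
    exact Real.le_sqrt_of_sq_le (by norm_num)
  · gcongr
    rw [Real.sqrt_le_left (by norm_num)]
    norm_num

theorem le_ellParam_or : ellParam T qI N = qI ∨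
    18 * Real.logb 2 T + Real.sqrt (330 * ((qI : ℝ) * rParam N qI / N) * T) ≤ ellParam T qI N := by
  unfold ellParam
  rcases min_choice ⌈18 * Real.logb 2 T + Real.sqrt (330 * ((qI : ℝ) * rParam N qI / N) * T)⌉₊ qI
    with h | h
  · right; rw [h]; exact Nat.le_ceil _
  · left; exact h

theorem ellParam_le (hT : 1 ≤ T) : (ellParam T qI N : ℝ) ≤
    18 * Real.logb 2 T + Real.sqrt (330 * ((qI : ℝ) * rParam N qI / N) * T) + 1 := by
  have hT' : (1 : ℝ) ≤ T := by exact_mod_cast hT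
  have := Real.logb_nonneg (b := 2) (by norm_num) hT'
  refine le_trans ?_ (Nat.ceil_lt_add_one (by positivity)).le
  exact Nat.cast_le.2 (min_le_left _ _)

/-- Either `ℓ = qI > 13 log N` or `ℓ ≥ 18 log T`, and both constants exceed 10. -/
theorem two_rpow_neg_ell_le (hT : 1 ≤ T) (hN : 0 < N) (hI : 13 * Real.logb 2 N < qI) :
    (2 : ℝ) ^ (-((ellParam T qI N : ℝ) / 10)) ≤ 1 / T + 1 / N := by
  have hT' : (1 : ℝ) ≤ T := by exact_mod_cast hT
  have hN' : (1 : ℝ) ≤ N := by exact_mod_cast hN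
  have hlT := Real.logb_nonneg (b := 2) (by norm_num) hT'
  have hlN := Real.logb_nonneg (b := 2) (by norm_num) hN'
  have key : ∀ X : ℝ, 1 ≤ X → 10 * Real.logb 2 X ≤ ellParam T qI N →
      (2 : ℝ) ^ (-((ellParam T qI N : ℝ) / 10)) ≤ 1 / X := by
    intro X hX h
    calc (2 : ℝ) ^ (-((ellParam T qI N : ℝ) / 10)) ≤ 2 ^ (-Real.logb 2 X) :=
          Real.rpow_le_rpow_of_exponent_le (by norm_num) (by linarith)
      _ = 1 / X := by
          rw [Real.rpow_neg (by norm_num), Real.rpow_logb (by norm_num) (by norm_num) (by linarith),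
            one_div]
  have h1 : (0 : ℝ) ≤ 1 / T := by positivity
  have h2 : (0 : ℝ) ≤ 1 / N := by positivity
  rcases le_ellParam_or (N := N) (qI := qI) (T := T) with h | h
  · have := key N hN' (by rw [h]; linarith)
    linarith
  · have := key T hT' (by
      have := Real.sqrt_nonneg (330 * ((qI : ℝ) * rParam N qI / N) * T)
      linarith)
    linarith

theorem four_le_Ybound (hT : 1 ≤ T) : 4 ≤ Ybound N qI T := by
  have hT' : (1 : ℝ) ≤ T := by exact_mod_cast hT
  have := Real.logb_nonneg (b := 2) (by norm_num) hT'
  have h : 0 ≤ max (52 * Real.logb 2 T)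
    (max (48 * Real.sqrt ((qI : ℝ) * rParam N qI / N * T)) (270 * ((rParam N qI : ℝ) / N) * T)) :=
    le_max_of_le_left (by positivity)
  unfold Ybound
  linarith

theorem ell_M_bounds (hT : 1 ≤ T) (hN : 0 < N) (hq : 0 < qI) (hY : Ybound N qI T ≤ T) :
    ellParam T qI N ≤ MParam T qI N ∧
      64 * qI * T ≤ MParam T qI N * ellParam T qI N := by
  have hl := ellParam_pos hN hq hT
  have hl' : (0 : ℝ) < ellParam T qI N := by exact_mod_cast hl
  have hlT : ellParam T qI N ≤ T := by
    have h1 := ellParam_le (N := N) (qI := qI) hT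
    have h2 := (sqrt_ell_bounds ((qI : ℝ) * rParam N qI / N * T)).2
    rw [← mul_assoc] at h2
    have h3 : 52 * Real.logb 2 T ≤ T - 4 := by
      have := le_max_left (52 * Real.logb 2 T) (max (48 * Real.sqrt ((qI : ℝ) * rParam N qI / N * T))
        (270 * ((rParam N qI : ℝ) / N) * T))
      unfold Ybound at hY; linarith
    have h4 : 48 * Real.sqrt ((qI : ℝ) * rParam N qI / N * T) ≤ T - 4 := by
      have := (le_max_left (48 * Real.sqrt ((qI : ℝ) * rParam N qI / N * T))
        (270 * ((rParam N qI : ℝ) / N) * T)).trans (le_max_right (52 * Real.logb 2 T) _)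
      unfold Ybound at hY; linarith
    have h5 : (4 : ℝ) ≤ T := (four_le_Ybound hT).trans hY
    have : (ellParam T qI N : ℝ) ≤ T := by linarith
    exact_mod_cast this
  have hM : 64 * qI * T ≤ MParam T qI N * ellParam T qI N := by
    have : 64 * (qI : ℝ) / ellParam T qI N * T ≤ MParam T qI N := Nat.le_ceil _
    rw [div_mul_eq_mul_div, div_le_iff₀ hl'] at this
    exact_mod_cast this
  refine ⟨?_, hM⟩
  -- If `M < ℓ`, then `ℓ ≤ T` and `ℓ ≤ qI` give `M ℓ ≤ T qI`, against `64 qI T ≤ M ℓ`.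
  by_contra hlt
  push Not at hlt
  have h1 : MParam T qI N * ellParam T qI N ≤ T * qI :=
    Nat.mul_le_mul (by omega) ellParam_le_qI
  have h2 : 0 < qI * T := Nat.mul_pos hq (by omega)
  nlinarith

/-- With `Y₀ = Y(T) - 4`, the plan and the representatives cost at most `0.8716 Y₀ + 5/2` and the
rest at most `82 T/N + 3`, where `T/N ≤ Y₀/2160`. Since `T ≥ 4`, also `Y₀ ≥ 104`, and the unused
part of `Y₀` absorbs the excess `3/2` of the constants. -/
theorem seed_bound_lt_Ybound (hT : 1 ≤ T) (hI : 13 * Real.logb 2 N < qI) (hq : 0 < qI)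
    (hr : 4 * rParam N qI < N) (hY : Ybound N qI T ≤ T) :
    (prelimTime N (MParam T qI N) (rParam N qI) : ℝ) + ellParam T qI N
      + ((2 * MParam T qI N + 32 * T) * (qI * (5 / 8) ^ rParam N qI)
        + T * (4 : ℝ) ^ (3 * ellParam T qI N / 32 : ℝ) * (13 / 16) ^ ellParam T qI N
        + T * 4 ^ T * Real.exp (-(2 * T))) < Ybound N qI T := by
  have hN : 0 < N := by omega
  have hr2 := two_le_rParam hN hq
  have hr8 := eight_le_rParam (by omega : 8 ≤ N) hq
  have hlpos := ellParam_pos hN hq hT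
  have hT4 : (4 : ℝ) ≤ T := (four_le_Ybound hT).trans hY
  have hlog2 : 2 ≤ Real.logb 2 T := by
    rw [Real.le_logb_iff_rpow_le (by norm_num) (by linarith)]
    norm_num; exact_mod_cast hT4
  have hw := sqrt_ell_bounds ((qI : ℝ) * rParam N qI / N * T)
  rw [← mul_assoc] at hw
  have hle := ellParam_le (N := N) (qI := qI) hT
  have hor := le_ellParam_or (N := N) (qI := qI) (T := T)
  have hpowr := pow_rParam_le (N := N) hN hq
  have hell := two_rpow_neg_ell_le (T := T) hT hN hI
  have hexp := mul_four_pow_mul_exp_le T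
  have hmid := rpow_mul_pow_le (ellParam T qI N)
  have hMle : (MParam T qI N : ℝ) ≤ 64 * (qI : ℝ) / ellParam T qI N * T + 1 :=
    (Nat.ceil_lt_add_one (by positivity)).le
  have hPle : (prelimTime N (MParam T qI N) (rParam N qI) : ℝ)
      ≤ 2 * (MParam T qI N : ℝ) * rParam N qI / N + 1 :=
    (Nat.ceil_lt_add_one (by positivity)).le
  have hs2 := Real.sq_sqrt (by positivity : 0 ≤ (qI : ℝ) * rParam N qI / N * T)
  have hs0 := Real.sqrt_nonneg ((qI : ℝ) * rParam N qI / N * T)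
  have hY1 := le_max_left (52 * Real.logb 2 T) (max (48 * Real.sqrt ((qI : ℝ) * rParam N qI / N * T))
        (270 * ((rParam N qI : ℝ) / N) * T))
  have hY2 := (le_max_left (48 * Real.sqrt ((qI : ℝ) * rParam N qI / N * T))
        (270 * ((rParam N qI : ℝ) / N) * T)).trans (le_max_right (52 * Real.logb 2 T) _)
  have hY3 := (le_max_right (48 * Real.sqrt ((qI : ℝ) * rParam N qI / N * T))
        (270 * ((rParam N qI : ℝ) / N) * T)).trans (le_max_right (52 * Real.logb 2 T) _)
  unfold Ybound
  clear hY
  set Y₀ := max (52 * Real.logb 2 T) (max (48 * Real.sqrt ((qI : ℝ) * rParam N qI / N * T))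
        (270 * ((rParam N qI : ℝ) / N) * T))
  set s := Real.sqrt ((qI : ℝ) * rParam N qI / N * T)
  set w := Real.sqrt (330 * ((qI : ℝ) * rParam N qI / N) * T)
  set P : ℝ := (prelimTime N (MParam T qI N) (rParam N qI) : ℝ)
  set M : ℝ := (MParam T qI N : ℝ)
  have hqI1 : (1 : ℝ) ≤ qI := by exact_mod_cast hq
  have hl1 : (1 : ℝ) ≤ ellParam T qI N := by exact_mod_cast hlpos
  have hr8' : (8 : ℝ) ≤ rParam N qI := by exact_mod_cast hr8
  have hrN : 4 * (rParam N qI : ℝ) ≤ N := by exact_mod_cast hr.le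
  have hN1 : (1 : ℝ) ≤ N := by exact_mod_cast hN
  have hT1 : (1 : ℝ) ≤ T := by exact_mod_cast hT
  generalize hℓ : (ellParam T qI N : ℝ) = ℓ at *
  generalize (rParam N qI : ℝ) = r at *
  have hN0 : (0 : ℝ) < N := by linarith
  have hℓ0 : 0 < ℓ := by linarith
  -- the preliminary exploration
  have hP : P ≤ 128 * s ^ 2 / ℓ + 3 / 2 := by
    have h1 : 2 * M * r / N ≤ 2 * (64 * (qI : ℝ) / ℓ * T + 1) * r / N := by gcongr
    have h2 : 2 * (64 * (qI : ℝ) / ℓ * T + 1) * r / N = 128 * s ^ 2 / ℓ + 2 * (r / N) := by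
      rw [hs2]; field_simp; ring
    have h3 : r / N ≤ 1 / 4 := by rw [div_le_iff₀ hN0]; linarith
    linarith
  have hPl : P + ℓ ≤ 0.8716 * Y₀ + 5 / 2 := by
    -- For `ℓ ≥ 18.16 s` the main terms are `18 log T + (18.17 + 7.05) s`, and `18/52 + 25.22/48 <
    -- 0.8716`. Otherwise `ℓ = qI`, the plan costs about `128 (r/N) T`, and `18.16/48 + 128/270 <
    -- 0.8716`.
    rcases le_or_gt (18.16 * s) ℓ with h | h
    · have : 128 * s ^ 2 / ℓ ≤ 7.05 * s := by
        rw [div_le_iff₀ hℓ0]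
        nlinarith
      linarith
    · have hq' : (qI : ℝ) = ℓ := by
        rcases hor with h' | h'
        · rw [← hℓ, h']
        · linarith [hw.1]
      have : 128 * s ^ 2 / ℓ = 128 * (r / N * T) := by
        rw [hs2, hq']; field_simp
      linarith
  -- confusion of item types
  have hTN : 0 ≤ (T : ℝ) / N := by positivity
  have hconf : (2 * M + 32 * T) * (qI * (5 / 8) ^ rParam N qI) ≤ 81 * (T / N) := by
    calc (2 * M + 32 * T) * (qI * (5 / 8) ^ rParam N qI)
        ≤ (2 * (64 * (qI : ℝ) / ℓ * T + 1) + 32 * T) * (1 / (2 * N * qI)) := by gcongr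
      _ = 64 * (T / N) * (1 / ℓ) + (1 / N + 16 * (T / N)) * (1 / qI) := by field_simp; ring
      _ ≤ 64 * (T / N) * 1 + (T / N + 16 * (T / N)) * 1 := by
          have h1 : 1 / ℓ ≤ 1 := by rw [div_le_one hℓ0]; exact hl1
          have h2 : 1 / (qI : ℝ) ≤ 1 := by rw [div_le_one (by linarith)]; exact hqI1
          gcongr
      _ = 81 * (T / N) := by ring
  have hmid' : T * (4 : ℝ) ^ (3 * ℓ / 32 : ℝ) * (13 / 16) ^ ellParam T qI N ≤ 1 + T / N := by
    rw [mul_assoc]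
    calc _ ≤ (T : ℝ) * (1 / T + 1 / N) := by gcongr; exact hmid.trans hell
      _ = 1 + T / N := by field_simp
  have hx : 8 * ((T : ℝ) / N) ≤ r / N * T := by
    rw [div_mul_eq_mul_div, mul_div_assoc]; gcongr
  linarith

end

/-! ### The regret -/

theorem regret_le {N qU qI : ℕ} [NeZero qU] [NeZero qI] {Z : Type} [Fintype Z] {ζ : PMF Z}
    {A : Z → Policy N} {T : ℕ} {B : ℝ}
    (h : ∀ z ∈ ζ.support, ∫ ω, loss (rating ω) (A z) T ∂(envLaw N qU qI) ≤ B) :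
    regret N qU qI ζ A T ≤ B := by
  have hsum : ∑ z, (ζ z).toReal = 1 := by
    rw [← ENNReal.toReal_sum fun z _ => ζ.apply_ne_top z, ← tsum_fintype (L := .unconditional Z),
      ζ.tsum_coe, ENNReal.toReal_one]
  calc regret N qU qI ζ A T ≤ ∑ z, (ζ z).toReal * B := by
        refine Finset.sum_le_sum fun z _ => ?_
        by_cases hz : ζ z = 0
        · simp [hz]
        · exact mul_le_mul_of_nonneg_left (h z ((ζ.mem_support_iff z).2 hz)) ENNReal.toReal_nonneg
    _ = B := by rw [← Finset.sum_mul, hsum, one_mul]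

theorem integral_loss_le {N qU qI T : ℕ} [NeZero qU] [NeZero qI] (A : Policy N) :
    ∫ ω, loss (rating ω) A T ∂(envLaw N qU qI) ≤ T := by
  refine (integral_loss_le_of_le (integrable_const (T : ℝ)) fun ω => loss_le _ _ _).trans ?_
  simp

/-- The `N.choose r` sets of size `r` already carry total mass 1, so no other set is in the support.
-/
theorem IsUniformPlan.card_users {N M P r : ℕ} {ν : PMF (Plan N M P)} (hν : IsUniformPlan r ν)
    (hr : r ≤ N) {S : Plan N M P} (hS : S ∈ ν.support) (k : Fin (2 * M)) :
    (S.users k).card = r := by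
  classical
  by_contra hne
  set q := ν.map fun S => S.users k with hq
  have hmem : S.users k ∈ q.support := by
    rw [hq, PMF.support_map]; exact ⟨S, hS, rfl⟩
  have h0 : ((N.choose r : ℕ) : ℝ≥0∞) ≠ 0 := by
    exact_mod_cast (Nat.choose_pos hr).ne'
  have h1 : ∑ V ∈ Finset.powersetCard r (Finset.univ : Finset (Fin N)), q V = 1 := by
    rw [Finset.sum_congr rfl fun V hV => hν.uniform k V (Finset.mem_powersetCard.1 hV).2,
      Finset.sum_const, Finset.card_powersetCard, Finset.card_univ, Fintype.card_fin, nsmul_eq_mul,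
      ENNReal.mul_inv_cancel h0 (ENNReal.natCast_ne_top _)]
  have h2 : q.support ⊆ ↑(Finset.powersetCard r (Finset.univ : Finset (Fin N))) := by
    rw [← PMF.toOuterMeasure_apply_eq_one_iff, PMF.toOuterMeasure_apply_finset, h1]
  exact hne (Finset.mem_powersetCard.1 (Finset.mem_coe.1 (h2 hmem))).2

theorem fst_mem_support_of_seedLaw {T qI N : ℕ} {ν : PMF (IIPlan T qI N)} {z : IISeed T qI N}
    (hz : z ∈ (seedLaw ν).support) : z.1 ∈ ν.support := by
  rw [seedLaw, PMF.mem_support_bind_iff] at hz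
  obtain ⟨S, hS, hz⟩ := hz
  rw [PMF.support_map] at hz
  obtain ⟨π, -, rfl⟩ := hz
  exact hS

theorem regret_itemItem_lt {N qU qI T : ℕ} [NeZero qU] [NeZero qI]
    (hT : 1 ≤ T) (hUN : qU ≤ N)
    (hI : 13 * Real.logb 2 N < qI) (hU : 4 * rParam N qI < qU)
    {ν : PMF (IIPlan T qI N)} (hν : IsUniformPlan (rParam N qI) ν)
    {pick : History N → Fin N → Finset ℕ → ℕ}
    (hpick : ∀ h u s, s.Nonempty → pick h u s ∈ s) :
    regret N qU qI (seedLaw ν) (itemItem T qI N pick) T < Ybound N qI T := by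
  -- The loss never exceeds `T`, so only `Y(T) ≤ T` needs the analysis; `ℓ ≤ M` is derived from it.
  rcases lt_or_ge (T : ℝ) (Ybound N qI T) with hY | hY
  · exact (regret_le fun z _ => integral_loss_le _).trans_lt hY
  have hq : 0 < qI := Nat.pos_of_ne_zero (NeZero.ne qI)
  have : NeZero N := ⟨by omega⟩
  obtain ⟨hℓM, hM⟩ := ell_M_bounds hT (by omega) hq hY
  refine (regret_le fun z hz => ?_).trans_lt
    (seed_bound_lt_Ybound hT hI hq (by omega) hY)
  exact integral_loss_itemItemPolicy_le hpick z.1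
    (hν.card_users (by omega) (fst_mem_support_of_seedLaw hz)) z.2 hU.le
    (ellParam_pos (by omega) hq hT) ellParam_le_qI hℓM hM

end ItemItemCF

open ItemItemCF in
theorem mainTheorem4 (N qU qI T : ℕ) [NeZero qU] [NeZero qI]
    (hT : 1 ≤ T) (hUN : qU ≤ N)
    (hI : 13 * Real.logb 2 N < qI) (hU : 4 * rParam N qI < qU)
    (ν : PMF (IIPlan T qI N)) (hν : IsUniformPlan (rParam N qI) ν)
    (pick : History N → Fin N → Finset ℕ → ℕ)
    (hpick : ∀ h u s, s.Nonempty → pick h u s ∈ s) :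
    regret N qU qI (seedLaw ν) (itemItem T qI N pick) T < Ybound N qI T ∧
    regret N qU qI (seedLaw ν) (itemItemOrTrivial T qI N pick) T
      ≤ min (Ybound N qI T) ((T : ℝ) / 2) := by
  have h1 := regret_itemItem_lt hT hUN hI hU hν hpick
  refine ⟨h1, ?_⟩
  -- The choice of the algorithm depends on the parameters alone, hence is the same for all seeds.
  by_cases hY : Ybound N qI T ≤ (T : ℝ) / 2
  · have hA : itemItemOrTrivial T qI N pick = itemItem T qI N pick := by
      funext z; rw [itemItemOrTrivial, if_pos hY]
    rw [hA, min_eq_left hY]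
    exact h1.le
  · have hA : itemItemOrTrivial T qI N pick = fun _ => trivialPolicy N := by
      funext z; rw [itemItemOrTrivial, if_neg hY]
    have : NeZero N := ⟨by omega⟩
    rw [hA, min_eq_right (not_le.1 hY).le]
    exact regret_le fun z _ => (integral_loss_trivialPolicy T).le
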